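/- A topological graph $E=(E^0,E^1,r,s)$ consists of locally compact Hausdorff spaces $E^0,E^1$, a continuous map $r:E^1\to E^0$ and a local homeomorphism $s:E^1\to E^0$. For $x\in C_c(E^1)$ and $f\in C_0(E^0)$ let $(f\cdot x)(e)=f(r(e))x(e)$ and $(x\cdot f)(e)=x(e)f(s(e))$; for $x,y\in C_c(E^1)$ let $\langle x,y\rangle(v)=\sum_{s(e)=v}\overline{x(e)}\,y(e)$. The graph correspondence $X(E)$ is the completion of $C_c(E^1)$ in the norm $\|x\|=\|\langle x,x\rangle\|_\infty^{1/2}$, with the $C_0(E^0)$-valued inner product and the left and right actions extended by continuity; write $\phi$ for its left action. Write $\operatorname{osupp}(x)=\{e:x(e)\neq0\}$ and $\operatorname{supp}(x)=\overline{\operatorname{osupp}(x)}$. A set $U\subset E^1$ is an $s$-section if $s|_U$ is a homeomorphism onto its image. If $\operatorname{osupp}(x)$ is an $s$-section, let $\widehat x(s(e))=|x(e)|^2$ for $e\in\operatorname{osupp}(x)$ and $\widehat x=0$ off $s(\operatorname{osupp}(x))$. A Toeplitz representation of $E$ in a $C^*$-algebra $B$ is a pair $(\psi,\pi)$ of a linear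 map $\psi:C_c(E^1)\to B$ and a $*$-homomorphism $\pi:C_0(E^0)\to B$ such that (1) $\psi(f\cdot x)=\pi(f)\psi(x)$; (2) $\pi(\widehat x)=\psi(x)^*\psi(x)$ whenever $\operatorname{supp}(x)$ is contained in an open $s$-section; (3) $\psi(x)^*\psi(y)=0$ whenever $\operatorname{supp}(x)$ and $\operatorname{supp}(y)$ are contained in disjoint open $s$-sections. Let $E^0_{\mathrm{sce}}=E^0\setminus\overline{r(E^1)}$, let $E^0_{\mathrm{fin}}$ be the set of $v\in E^0$ having a neighbourhood $N$ with $r^{-1}(N)$ compact, and let $E^0_{\mathrm{rg}}=E^0_{\mathrm{fin}}\setminus\overline{E^0_{\mathrm{sce}}}$. For a nonnegative $f\in C_c(E^0_{\mathrm{rg}})$ and a finite cover $\mathcal N$ of $r^{-1}(\operatorname{supp}f)$ by open $s$-sections, a compatible partition is a family of nonnegative functions $f_N\in C_c(E^1)$, $N\in\mathcal N$, with $\operatorname{osupp}(f_N)\subset N\cap r^{-1}(\operatorname{supp}f)$ and $\sum_{N\in\mathcal N}f_N=f\circ r$. The representation $(\psi,\pi)$ is covariant if there is a set $\mathcal G$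 of nonnegative functions in $C_c(E^0_{\mathrm{rg}})$ that generates $C_0(E^0_{\mathrm{rg}})$ as a $C^*$-algebra such that for each $f\in\mathcal G$ there exist a finite cover $\mathcal N$ of $r^{-1}(\operatorname{supp}f)$ by open $s$-sections and a compatible partition $(f_N)_{N\in\mathcal N}$ with $\pi(f)=\sum_{N\in\mathcal N}\psi(\sqrt{f_N})\psi(\sqrt{f_N})^*$. Proposition. Let $E$ be a topological graph and let $(\psi,\pi)$ be a covariant Toeplitz representation of $E$ in a $C^*$-algebra $B$. Then $\psi$ extends uniquely to a bounded linear map $\widetilde\psi:X(E)\to B$, and $(\widetilde\psi,\pi)$ is a covariant Toeplitz representation of $X(E)$ in Katsura's sense: $\widetilde\psi(a\cdot x)=\pi(a)\widetilde\psi(x)$ and $\widetilde\psi(x)^*\widetilde\psi(y)=\pi(\langle x,y\rangle)$ for all $x,y\in X(E)$, $a\in C_0(E^0)$, and $\widetilde\psi^{(1)}(\phi(a))=\pi(a)$ for all $a\in\phi^{-1}(\mathcal K(X(E)))\cap(\ker\phi)^\perp$. Here $\mathcal K(X(E))$ is the closed linear span of the operators $\Theta_{x,y}:z\mapsto x\cdot\langle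 y,z\rangle$, $\widetilde\psi^{(1)}:\mathcal K(X(E))\to B$ is the $*$-homomorphism with $\widetilde\psi^{(1)}(\Theta_{x,y})=\widetilde\psi(x)\widetilde\psi(y)^*$, and $(\ker\phi)^\perp=\{a:ab=0\text{ for all }b\in\ker\phi\}$. Moreover, $\pi(f)=\sum_{N\in\mathcal N}\psi(\sqrt{f_N})\psi(\sqrt{f_N})^*$ for every nonnegative $f\in C_c(E^0_{\mathrm{rg}})$, every finite cover $\mathcal N$ of $r^{-1}(\operatorname{supp}f)$ by open $s$-sections, and every compatible partition $(f_N)_{N\in\mathcal N}$. -/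

import Mathlib

open scoped ZeroAtInfty CompactlySupported ComplexOrder

noncomputable section

open Topology Set Function

set_option linter.unusedSectionVars false

/-- A C⋆-correspondence `X` over `A`: a right Hilbert `A`-module with a left action of `A` by
adjointable operators. The boundedness of the inner product and of the two actions, which is
automatic, is part of their types. -/
structure CStarCorrespondence (A X : Type*) [NonUnitalCStarAlgebra A] [NormedAddCommGroup X]
    [NormedSpace ℂ X] [CompleteSpace X] where
  /-- The `A`-valued inner product. -/
  ip : X →L⋆[ℂ] X →L[ℂ] A
  /-- The right action `right x a = x · a`. -/
  right : X →L[ℂ] A →L[ℂ] X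
  /-- The left action `left a x = a · x`. -/
  left : A →ₙₐ[ℂ] (X →L[ℂ] X)
  right_mul : ∀ x a b, right x (a * b) = right (right x a) b
  ip_self_nonneg : ∀ x, ∃ b, ip x x = star b * b
  norm_sq : ∀ x, ‖x‖ ^ 2 = ‖ip x x‖
  ip_right : ∀ x y a, ip x (right y a) = ip x y * a
  star_ip : ∀ x y, star (ip y x) = ip x y
  ip_left : ∀ a x y, ip (left (star a) y) x = ip y (left a x)

namespace CStarCorrespondence

variable {A X : Type*} [NonUnitalCStarAlgebra A] [NormedAddCommGroup X] [NormedSpace ℂ X]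
  [CompleteSpace X]

/-- The operator `Θ_{x,y} z = x · ⟨y, z⟩`. -/
def theta (C : CStarCorrespondence A X) (x y : X) : X →L[ℂ] X := (C.right x).comp (C.ip y)

/-- `S` is an adjoint of `T`: `⟨S y, x⟩ = ⟨y, T x⟩` for all `x`, `y`. -/
def IsAdjointOf (C : CStarCorrespondence A X) (S T : X →L[ℂ] X) : Prop :=
  ∀ x y, C.ip (S y) x = C.ip y (T x)

lemma theta_mul_theta (C : CStarCorrespondence A X) (x y u v : X) :
    C.theta x y * C.theta u v = C.theta (C.right x (C.ip y u)) v := by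
  ext z
  simp [theta, C.ip_right, C.right_mul]

lemma mul_mem_span (C : CStarCorrespondence A X) {S T : X →L[ℂ] X}
    (hS : S ∈ Submodule.span ℂ (range (uncurry C.theta)))
    (hT : T ∈ Submodule.span ℂ (range (uncurry C.theta))) :
    S * T ∈ Submodule.span ℂ (range (uncurry C.theta)) := by
  have h := Submodule.mul_mem_mul hS hT
  rw [Submodule.span_mul_span] at h
  refine Submodule.span_mono ?_ h
  rintro _ ⟨_, ⟨⟨x, y⟩, rfl⟩, _, ⟨⟨u, v⟩, rfl⟩, rfl⟩
  exact ⟨(C.right x (C.ip y u), v), (C.theta_mul_theta x y u v).symm⟩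

/-- The compact operators `𝒦(X)`: the closed linear span of the operators `Θ_{x,y}`. -/
def compacts (C : CStarCorrespondence A X) : NonUnitalSubalgebra ℂ (X →L[ℂ] X) where
  carrier := closure (Submodule.span ℂ (range (uncurry C.theta)) : Set (X →L[ℂ] X))
  zero_mem' := (Submodule.span ℂ (range (uncurry C.theta))).topologicalClosure.zero_mem
  add_mem' := (Submodule.span ℂ (range (uncurry C.theta))).topologicalClosure.add_mem
  smul_mem' c _ := (Submodule.span ℂ (range (uncurry C.theta))).topologicalClosure.smul_mem c
  mul_mem' hS hT := map_mem_closure₂ continuous_mul hS hT fun _ hS _ hT => C.mul_mem_span hS hT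

lemma theta_mem_compacts (C : CStarCorrespondence A X) (x y : X) : C.theta x y ∈ C.compacts :=
  subset_closure (Submodule.subset_span ⟨(x, y), rfl⟩)

variable {B : Type*} [NonUnitalCStarAlgebra B]

/-- Toeplitz representations of a C⋆-correspondence in a C⋆-algebra. -/
structure IsToeplitzRep (C : CStarCorrespondence A X) (ψ : X →ₗ[ℂ] B) (π : A →⋆ₙₐ[ℂ] B) :
    Prop where
  map_left : ∀ a x, ψ (C.left a x) = π a * ψ x
  star_mul : ∀ x y, star (ψ x) * ψ y = π (C.ip x y)

/-- `ψ₁` is the `*`-homomorphism `ψ⁽¹⁾ : 𝒦(X) → B` with `ψ⁽¹⁾(Θ_{x,y}) = ψ(x) ψ(y)^*`. -/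
structure IsInducedHom (C : CStarCorrespondence A X) (ψ : X →ₗ[ℂ] B)
    (ψ₁ : C.compacts →ₙₐ[ℂ] B) : Prop where
  map_adjoint : ∀ S T : C.compacts, C.IsAdjointOf S T → ψ₁ S = star (ψ₁ T)
  map_theta : ∀ x y, ψ₁ ⟨C.theta x y, C.theta_mem_compacts x y⟩ = ψ x * star (ψ y)

/-- Covariance of a Toeplitz representation: `ψ⁽¹⁾(φ(a)) = π(a)` for all
`a ∈ φ⁻¹(𝒦(X)) ∩ (ker φ)^⊥`, where `φ` is the left action. The homomorphism `ψ⁽¹⁾` is determined by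
`ψ` because homomorphisms of C⋆-algebras are continuous. -/
structure IsCovariantRep (C : CStarCorrespondence A X) (ψ : X →ₗ[ℂ] B) (π : A →⋆ₙₐ[ℂ] B) :
    Prop extends C.IsToeplitzRep ψ π where
  covariant : ∃ ψ₁ : C.compacts →ₙₐ[ℂ] B, C.IsInducedHom ψ ψ₁ ∧
    ∀ (a : A) (ha : C.left a ∈ C.compacts), (∀ b, C.left b = 0 → a * b = 0) →
      ψ₁ ⟨C.left a, ha⟩ = π a

end CStarCorrespondence

/-- A topological graph on the spaces `E⁰` of vertices and `E¹` of edges; these are assumed to be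
locally compact and Hausdorff wherever topological graphs are used. -/
structure TopologicalGraph (E0 E1 : Type*) [TopologicalSpace E0] [TopologicalSpace E1] where
  r : E1 → E0
  s : E1 → E0
  continuous_r : Continuous r
  isLocalHomeomorph_s : IsLocalHomeomorph s

namespace TopologicalGraph

variable {E0 E1 : Type*} [TopologicalSpace E0] [TopologicalSpace E1]

/-- The sum `∑_{s(e) = v} z(e)`; it is finite if `z` has compact support. -/
def fiberSum (E : TopologicalGraph E0 E1) (z : E1 → ℂ) (v : E0) : ℂ :=
  ∑ᶠ e ∈ E.s ⁻¹' {v}, z e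

lemma finite_fiber [T2Space E0] (E : TopologicalGraph E0 E1) {z : E1 → ℂ}
    (hz : HasCompactSupport z) (v : E0) : (E.s ⁻¹' {v} ∩ support z).Finite := by
  have hc : IsCompact (tsupport z ∩ E.s ⁻¹' {v}) :=
    hz.isCompact.inter_right (isClosed_singleton.preimage E.isLocalHomeomorph_s.continuous)
  have hd : IsDiscrete (tsupport z ∩ E.s ⁻¹' {v}) := by
    refine IsLocalHomeomorphOn.isDiscrete_of_image (f := E.s)
      (E.isLocalHomeomorph_s.isLocalHomeomorphOn.mono (subset_univ _)) ?_
    refine Set.Subsingleton.isDiscrete ?_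
    rintro _ ⟨a, ha, rfl⟩ _ ⟨b, hb, rfl⟩
    exact ha.2.trans hb.2.symm
  refine (hc.finite hd).subset ?_
  rintro e ⟨h1, h2⟩
  exact ⟨subset_tsupport _ h2, h1⟩

lemma fiberSum_add [T2Space E0] (E : TopologicalGraph E0 E1) {z w : E1 → ℂ}
    (hz : HasCompactSupport z) (hw : HasCompactSupport w) (v : E0) :
    E.fiberSum (fun e => z e + w e) v = E.fiberSum z v + E.fiberSum w v :=
  finsum_mem_add_distrib' (E.finite_fiber hz v) (E.finite_fiber hw v)

lemma fiberSum_mul_left (E : TopologicalGraph E0 E1) (c : ℂ) (z : E1 → ℂ) (v : E0) :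
    E.fiberSum (fun e => c * z e) v = c * E.fiberSum z v := by
  unfold fiberSum
  rw [mul_finsum_mem]

lemma hasCompactSupport_sum {n : ℕ} {z : Fin n → E1 → ℂ} (hz : ∀ i, HasCompactSupport (z i))
    (t : Finset (Fin n)) : HasCompactSupport (fun e => ∑ i ∈ t, z i e) := by
  classical
  induction t using Finset.induction_on with
  | empty =>
    simp only [Finset.sum_empty]
    exact (HasCompactSupport.zero : HasCompactSupport (0 : E1 → ℂ))
  | insert a t ha ih =>
    simp only [Finset.sum_insert ha]
    exact (hz a).add ih

lemma fiberSum_sum [T2Space E0] (E : TopologicalGraph E0 E1) {n : ℕ} {z : Fin n → E1 → ℂ}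
    (hz : ∀ i, HasCompactSupport (z i)) (v : E0) (t : Finset (Fin n)) :
    E.fiberSum (fun e => ∑ i ∈ t, z i e) v = ∑ i ∈ t, E.fiberSum (z i) v := by
  classical
  induction t using Finset.induction_on with
  | empty => simp [fiberSum]
  | insert a t ha ih =>
    simp only [Finset.sum_insert ha]
    rw [E.fiberSum_add (hz a) (hasCompactSupport_sum hz t), ih]

lemma fiberSum_eq_zero (E : TopologicalGraph E0 E1) {z : E1 → ℂ} {v : E0}
    (hv : v ∉ E.s '' support z) : E.fiberSum z v = 0 := by
  refine finsum_mem_eq_zero_of_forall_eq_zero fun e he => ?_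
  by_contra h
  exact hv ⟨e, h, he⟩

lemma fiberSum_apply_of_injOn (E : TopologicalGraph E0 E1) {z : E1 → ℂ} {U : Set E1}
    (hU : InjOn E.s U) (hz : support z ⊆ U) {e : E1} (he : e ∈ U) :
    E.fiberSum z (E.s e) = z e := by
  unfold fiberSum
  rw [finsum_eq_single _ e]
  · simp
  intro e' hne
  by_contra h0
  obtain ⟨he', h⟩ : ∃ _ : e' ∈ E.s ⁻¹' {E.s e}, z e' ≠ 0 := by
    by_contra hc
    push Not at hc
    exact h0 (by simp only [mem_preimage, mem_singleton_iff] at hc ⊢; by_cases h : E.s e' = E.s e <;> simp [h, hc])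
  exact hne (hU (hz h) he he')

lemma continuous_fiberSum_of_source [T2Space E0] (E : TopologicalGraph E0 E1)
    {z : E1 → ℂ} (hc : Continuous z) (hz : HasCompactSupport z)
    (φ : OpenPartialHomeomorph E1 E0) (hφ : E.s = φ) (hs : tsupport z ⊆ φ.source) :
    Continuous (E.fiberSum z) := by
  rw [continuous_iff_continuousAt]
  intro v
  by_cases hv : v ∈ E.s '' tsupport z
  · obtain ⟨e, he, rfl⟩ := hv
    have hmem : E.s e ∈ φ.target := by rw [hφ]; exact φ.map_source (hs he)
    have : E.fiberSum z =ᶠ[𝓝 (E.s e)] fun v => z (φ.symm v) := by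
      filter_upwards [φ.open_target.mem_nhds hmem] with w hw
      have h1 : E.s (φ.symm w) = w := by rw [hφ]; exact φ.right_inv hw
      have h2 := E.fiberSum_apply_of_injOn (z := z) (U := φ.source) (by rw [hφ]; exact φ.injOn)
        ((subset_tsupport z).trans hs) (φ.map_target hw)
      rwa [h1] at h2
    refine ContinuousAt.congr ?_ this.symm
    exact hc.continuousAt.comp (φ.symm.continuousAt hmem)
  · have hcl : IsClosed (E.s '' tsupport z) :=
      (hz.isCompact.image E.isLocalHomeomorph_s.continuous).isClosed
    have : E.fiberSum z =ᶠ[𝓝 v] fun _ => 0 := by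
      filter_upwards [hcl.isOpen_compl.mem_nhds hv] with w hw
      exact E.fiberSum_eq_zero fun h => hw (image_mono (subset_tsupport z) h)
    exact continuousAt_const.congr this.symm

lemma continuous_fiberSum [T2Space E0] [T2Space E1] [LocallyCompactSpace E1]
    (E : TopologicalGraph E0 E1) {z : E1 → ℂ} (hc : Continuous z) (hz : HasCompactSupport z) :
    Continuous (E.fiberSum z) := by
  choose φ hφ1 hφ2 using E.isLocalHomeomorph_s
  obtain ⟨t, ht⟩ := hz.isCompact.elim_finite_subcover (fun e => (φ e).source)
    (fun e => (φ e).open_source) (fun e _ => mem_iUnion.2 ⟨e, hφ1 e⟩)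
  let ι := t.equivFin
  obtain ⟨h, h1, h2, -, -⟩ := exists_continuous_sum_one_of_isOpen_isCompact
    (s := fun i => (φ (ι.symm i)).source) (fun i => (φ (ι.symm i)).open_source) hz.isCompact (by
      intro e he
      obtain ⟨a, ha, hea⟩ := mem_iUnion₂.1 (ht he)
      exact mem_iUnion.2 ⟨ι ⟨a, ha⟩, by simpa using hea⟩)
  have hcs : ∀ i, HasCompactSupport (fun e => (h i e : ℂ) * z e) := fun i => hz.mul_left
  have hsum : z = fun e => ∑ i, (h i e : ℂ) * z e := by
    funext e
    by_cases he : e ∈ tsupport z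
    · have := h2 he
      simp only [Finset.sum_apply, Pi.one_apply] at this
      rw [← Finset.sum_mul, ← Complex.ofReal_sum, this]
      simp
    · simp [image_eq_zero_of_notMem_tsupport he]
  have : E.fiberSum z = fun v => ∑ i, E.fiberSum (fun e => (h i e : ℂ) * z e) v := by
    funext v
    rw [← E.fiberSum_sum hcs v Finset.univ, ← hsum]
  rw [this]
  refine continuous_finsetSum _ fun i _ => ?_
  refine E.continuous_fiberSum_of_source (by fun_prop) (hcs i) (φ (ι.symm i)) (hφ2 _) ?_
  refine (closure_mono ?_).trans (h1 i)
  intro e he h0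
  exact he (by simp [h0])

lemma hasCompactSupport_fiberSum [T2Space E0]
    (E : TopologicalGraph E0 E1) {z : E1 → ℂ} (hz : HasCompactSupport z) :
    HasCompactSupport (E.fiberSum z) :=
  HasCompactSupport.intro (hz.isCompact.image E.isLocalHomeomorph_s.continuous)
    fun _ hv => E.fiberSum_eq_zero fun h => hv (image_mono (subset_tsupport z) h)


lemma fiberSum_nonneg (E : TopologicalGraph E0 E1) {z : E1 → ℂ} (hz : ∀ e, 0 ≤ z e) (v : E0) :
    0 ≤ E.fiberSum z v :=
  finsum_nonneg fun e => finsum_nonneg fun _ => hz e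

lemma fiberSum_mono [T2Space E0] (E : TopologicalGraph E0 E1) {z w : E1 → ℂ}
    (hz : HasCompactSupport z) (hw : HasCompactSupport w) (h : ∀ e, z e ≤ w e) (v : E0) :
    E.fiberSum z v ≤ E.fiberSum w v := by
  have h1 := E.fiberSum_add hz (hw.sub hz) v
  have h2 := E.fiberSum_nonneg (z := w - z) (fun e => sub_nonneg.2 (h e)) v
  simp only [Pi.sub_apply, add_sub_cancel] at h1
  rw [h1]
  exact le_add_of_nonneg_right h2

lemma fiberSum_star [T2Space E0] (E : TopologicalGraph E0 E1) {z : E1 → ℂ}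
    (hz : HasCompactSupport z) (v : E0) :
    star (E.fiberSum z v) = E.fiberSum (fun e => star (z e)) v := by
  unfold fiberSum
  exact (starAddEquiv (R := ℂ)).toAddMonoidHom.map_finsum_mem' (E.finite_fiber hz v)

/-- The left action `(f · x)(e) = f(r(e)) x(e)` of `C₀(E⁰)` on `C_c(E¹)`. -/
def lact (E : TopologicalGraph E0 E1) (f : C₀(E0, ℂ)) (x : C_c(E1, ℂ)) : C_c(E1, ℂ) where
  toFun e := f (E.r e) * x e
  continuous_toFun := (f.continuous.comp E.continuous_r).mul x.continuous
  hasCompactSupport' := x.hasCompactSupport.mul_left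

/-- The right action `(x · f)(e) = x(e) f(s(e))` of `C₀(E⁰)` on `C_c(E¹)`. -/
def ract (E : TopologicalGraph E0 E1) (x : C_c(E1, ℂ)) (f : C₀(E0, ℂ)) : C_c(E1, ℂ) where
  toFun e := x e * f (E.s e)
  continuous_toFun := x.continuous.mul (f.continuous.comp E.isLocalHomeomorph_s.continuous)
  hasCompactSupport' := x.hasCompactSupport.mul_right

lemma hasCompactSupport_star_mul (x y : C_c(E1, ℂ)) :
    HasCompactSupport (fun e => star (x e) * y e) := y.hasCompactSupport.mul_left

variable [T2Space E0] [T2Space E1] [LocallyCompactSpace E1]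

/-- The `C₀(E⁰)`-valued inner product `⟨x, y⟩(v) = ∑_{s(e) = v} conj (x e) * y e`. -/
def preInner (E : TopologicalGraph E0 E1) (x y : C_c(E1, ℂ)) : C₀(E0, ℂ) where
  toFun := E.fiberSum fun e => star (x e) * y e
  continuous_toFun := E.continuous_fiberSum (by fun_prop) (hasCompactSupport_star_mul x y)
  zero_at_infty' := (E.hasCompactSupport_fiberSum (hasCompactSupport_star_mul x y)).is_zero_at_infty

lemma preInner_apply (E : TopologicalGraph E0 E1) (x y : C_c(E1, ℂ)) (v : E0) :
    E.preInner x y v = E.fiberSum (fun e => star (x e) * y e) v := rfl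


lemma fiberSum_self (E : TopologicalGraph E0 E1) (x : C_c(E1, ℂ)) (e : E1) :
    star (x e) * x e ≤ E.preInner x x (E.s e) := by
  rw [preInner_apply]
  have hfin := E.finite_fiber (hasCompactSupport_star_mul x x) (E.s e)
  by_cases h : star (x e) * x e = 0
  · rw [h]; exact E.fiberSum_nonneg (fun e => star_mul_self_nonneg _) _
  · unfold fiberSum
    rw [finsum_mem_eq_sum _ hfin]
    refine Finset.single_le_sum (f := fun e => star (x e) * x e)
      (fun i _ => star_mul_self_nonneg (x i)) ?_
    simp only [Finite.mem_toFinset]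
    exact ⟨rfl, h⟩

lemma preInner_add_right (E : TopologicalGraph E0 E1) (x y z : C_c(E1, ℂ)) :
    E.preInner x (y + z) = E.preInner x y + E.preInner x z := by
  ext v
  have := E.fiberSum_add (hasCompactSupport_star_mul x y) (hasCompactSupport_star_mul x z) v
  simp only [preInner_apply, ZeroAtInftyContinuousMap.add_apply,
    CompactlySupportedContinuousMap.add_apply, mul_add, this]

lemma preInner_smul_right (E : TopologicalGraph E0 E1) (c : ℂ) (x y : C_c(E1, ℂ)) :
    E.preInner x (c • y) = c • E.preInner x y := by
  ext v
  simp only [preInner_apply, ZeroAtInftyContinuousMap.smul_apply, smul_eq_mul,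
    CompactlySupportedContinuousMap.smul_apply, ← fiberSum_mul_left]
  congr 1
  funext e
  ring

lemma star_preInner (E : TopologicalGraph E0 E1) (x y : C_c(E1, ℂ)) :
    star (E.preInner x y) = E.preInner y x := by
  ext v
  rw [ZeroAtInftyContinuousMap.star_apply, preInner_apply, preInner_apply,
    E.fiberSum_star (hasCompactSupport_star_mul x y)]
  congr 1
  funext e
  rw [star_mul, star_star]

lemma preInner_ract (E : TopologicalGraph E0 E1) (x y : C_c(E1, ℂ)) (f : C₀(E0, ℂ)) :
    E.preInner x (E.ract y f) = E.preInner x y * f := by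
  ext v
  rw [ZeroAtInftyContinuousMap.mul_apply, preInner_apply, preInner_apply, mul_comm,
    ← fiberSum_mul_left]
  unfold fiberSum
  refine finsum_mem_congr rfl fun e he => ?_
  have : E.s e = v := he
  simp only [ract, CompactlySupportedContinuousMap.coe_mk, ContinuousMap.coe_mk, this]
  ring

lemma preInner_lact (E : TopologicalGraph E0 E1) (x y : C_c(E1, ℂ)) (f : C₀(E0, ℂ)) :
    E.preInner (E.lact (star f) y) x = E.preInner y (E.lact f x) := by
  ext v
  rw [preInner_apply, preInner_apply]
  congr 1
  funext e
  simp only [lact, CompactlySupportedContinuousMap.coe_mk, ContinuousMap.coe_mk,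
    ZeroAtInftyContinuousMap.star_apply, star_mul, star_star]
  ring

lemma exists_sqrt {X : Type*} [TopologicalSpace X] (f : C₀(X, ℂ)) (hf : ∀ v, 0 ≤ f v) :
    ∃ b : C₀(X, ℂ), f = star b * b := by
  refine ⟨⟨⟨fun v => ((√(f v).re : ℝ) : ℂ), by fun_prop⟩, ?_⟩, ?_⟩
  · have h := zero_at_infty f
    have hc : Continuous fun z : ℂ => ((√z.re : ℝ) : ℂ) := by fun_prop
    have h2 := (hc.tendsto 0).comp h
    simp only [Complex.zero_re, Real.sqrt_zero, Complex.ofReal_zero] at h2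
    exact h2
  · ext v
    obtain ⟨h1, h2⟩ := Complex.nonneg_iff.1 (hf v)
    rw [ZeroAtInftyContinuousMap.mul_apply, ZeroAtInftyContinuousMap.star_apply]
    change f v = star ((√(f v).re : ℝ) : ℂ) * ((√(f v).re : ℝ) : ℂ)
    rw [Complex.star_def, Complex.conj_ofReal, ← Complex.ofReal_mul, Real.mul_self_sqrt h1]
    exact Complex.ext (by simp) (by simp [← h2])

lemma preInner_self_nonneg (E : TopologicalGraph E0 E1) (x : C_c(E1, ℂ)) (v : E0) :
    0 ≤ E.preInner x x v :=
  E.fiberSum_nonneg (fun e => star_mul_self_nonneg (x e)) v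

lemma preInner_self_eq_zero (E : TopologicalGraph E0 E1) (x : C_c(E1, ℂ)) :
    E.preInner x x = 0 ↔ x = 0 := by
  constructor
  · intro h
    ext e
    have h1 := E.fiberSum_self x e
    rw [h, ZeroAtInftyContinuousMap.zero_apply] at h1
    have := le_antisymm h1 (star_mul_self_nonneg (x e))
    simpa using this
  · rintro rfl
    ext v
    simp [preInner_apply, fiberSum]

/-- `C_c(E¹)` with the norm `‖x‖² = ‖⟨x, x⟩‖`. -/
def PreCorr (_E : TopologicalGraph E0 E1) : Type _ := C_c(E1, ℂ)

instance (E : TopologicalGraph E0 E1) : AddCommGroup E.PreCorr :=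
  inferInstanceAs (AddCommGroup C_c(E1, ℂ))

instance (E : TopologicalGraph E0 E1) : Module ℂ E.PreCorr :=
  inferInstanceAs (Module ℂ C_c(E1, ℂ))

instance (E : TopologicalGraph E0 E1) : Norm E.PreCorr where
  norm x := √‖E.preInner x x‖

lemma preCorr_core (E : TopologicalGraph E0 E1) :
    NormedSpace.Core ℂ E.PreCorr ∧ ∀ x y : E.PreCorr, ‖E.preInner x y‖ ≤ ‖x‖ * ‖y‖ := by
  let _ : PartialOrder C₀(E0, ℂ) := CStarAlgebra.spectralOrder _
  have _ : StarOrderedRing C₀(E0, ℂ) := CStarAlgebra.spectralOrderedRing _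
  let _ : SMul C₀(E0, ℂ) E.PreCorr := ⟨fun f x => E.ract x f⟩
  let inst : CStarModule C₀(E0, ℂ) E.PreCorr :=
    { inner := E.preInner
      inner_add_right := E.preInner_add_right _ _ _
      inner_self_nonneg := by
        intro x
        obtain ⟨b, hb⟩ := exists_sqrt (E.preInner x x) (E.preInner_self_nonneg x)
        rw [hb]
        exact star_mul_self_nonneg b
      inner_self := E.preInner_self_eq_zero _
      inner_op_smul_right := by
        intro a x y
        rw [mul_comm]
        exact E.preInner_ract x y a
      inner_smul_right_complex := E.preInner_smul_right _ _ _
      star_inner := E.star_preInner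
      norm_eq_sqrt_norm_inner_self := fun _ => rfl }
  exact ⟨CStarModule.normedSpaceCore C₀(E0, ℂ), fun x y =>
    CStarModule.norm_inner_le (A := C₀(E0, ℂ)) E.PreCorr (x := x) (y := y)⟩

instance (E : TopologicalGraph E0 E1) : NormedAddCommGroup E.PreCorr :=
  NormedAddCommGroup.ofCore E.preCorr_core.1

instance (E : TopologicalGraph E0 E1) : NormedSpace ℂ E.PreCorr :=
  NormedSpace.ofCore E.preCorr_core.1

/-- The identity map from `C_c(E¹)` to its copy carrying the norm of the inner product. -/
def toPre (E : TopologicalGraph E0 E1) : C_c(E1, ℂ) ≃ₗ[ℂ] E.PreCorr := LinearEquiv.refl ℂ _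

lemma preCorr_norm_sq (E : TopologicalGraph E0 E1) (x : C_c(E1, ℂ)) :
    ‖E.toPre x‖ ^ 2 = ‖E.preInner x x‖ := Real.sq_sqrt (norm_nonneg _)

lemma norm_preInner_le (E : TopologicalGraph E0 E1) (x y : C_c(E1, ℂ)) :
    ‖E.preInner x y‖ ≤ ‖E.toPre x‖ * ‖E.toPre y‖ := E.preCorr_core.2 x y

lemma preCorr_norm_le (E : TopologicalGraph E0 E1) {x y : C_c(E1, ℂ)} {c : ℝ} (hc : 0 ≤ c)
    (h : ∀ v, ‖E.preInner y y v‖ ≤ c ^ 2 * ‖E.preInner x x v‖) : ‖E.toPre y‖ ≤ c * ‖E.toPre x‖ := by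
  refine abs_le_of_sq_le_sq' ?_ (by positivity) |>.2
  rw [mul_pow, preCorr_norm_sq, preCorr_norm_sq]
  rw [← ZeroAtInftyContinuousMap.norm_toBCF_eq_norm]
  refine (BoundedContinuousFunction.norm_le (by positivity)).2 fun v => (h v).trans ?_
  gcongr
  rw [← ZeroAtInftyContinuousMap.norm_toBCF_eq_norm]
  exact BoundedContinuousFunction.norm_coe_le_norm (E.preInner x x).toBCF v

lemma norm_apply_le {X : Type*} [TopologicalSpace X] (f : C₀(X, ℂ)) (v : X) : ‖f v‖ ≤ ‖f‖ := by
  rw [← ZeroAtInftyContinuousMap.norm_toBCF_eq_norm]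
  exact BoundedContinuousFunction.norm_coe_le_norm f.toBCF v

lemma norm_ract_le (E : TopologicalGraph E0 E1) (x : C_c(E1, ℂ)) (f : C₀(E0, ℂ)) :
    ‖E.toPre (E.ract x f)‖ ≤ ‖f‖ * ‖E.toPre x‖ := by
  refine E.preCorr_norm_le (norm_nonneg f) fun v => ?_
  have h : E.preInner (E.ract x f) (E.ract x f) = star f * E.preInner x x * f := by
    have h0 : star (E.preInner x x * f) = star f * star (E.preInner x x) :=
      star_mul (R := C₀(E0, ℂ)) _ _
    rw [preInner_ract, ← star_preInner, preInner_ract, h0, star_preInner]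
  rw [h]
  simp only [ZeroAtInftyContinuousMap.mul_apply, ZeroAtInftyContinuousMap.star_apply, norm_mul,
    norm_star]
  have := norm_apply_le f v
  calc ‖f v‖ * ‖E.preInner x x v‖ * ‖f v‖ = ‖f v‖ ^ 2 * ‖E.preInner x x v‖ := by ring
    _ ≤ _ := by gcongr

lemma norm_lact_le (E : TopologicalGraph E0 E1) (f : C₀(E0, ℂ)) (x : C_c(E1, ℂ)) :
    ‖E.toPre (E.lact f x)‖ ≤ ‖f‖ * ‖E.toPre x‖ := by
  refine E.preCorr_norm_le (norm_nonneg f) fun v => ?_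
  have h : E.preInner (E.lact f x) (E.lact f x) v ≤
      ((‖f‖ ^ 2 : ℝ) : ℂ) * E.preInner x x v := by
    rw [preInner_apply, preInner_apply, ← fiberSum_mul_left]
    refine E.fiberSum_mono (hasCompactSupport_star_mul _ _)
      (hasCompactSupport_star_mul x x).mul_left (fun e => ?_) v
    have h1 := norm_apply_le f (E.r e)
    have h2 : star (E.lact f x e) * E.lact f x e =
        ((‖f (E.r e)‖ ^ 2 : ℝ) : ℂ) * (star (x e) * x e) := by
      change star (f (E.r e) * x e) * (f (E.r e) * x e) = _
      have : ((‖f (E.r e)‖ ^ 2 : ℝ) : ℂ) = star (f (E.r e)) * f (E.r e) := by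
        rw [Complex.star_def, Complex.conj_mul']; push_cast; rfl
      rw [this, star_mul]
      ring
    rw [h2]
    refine mul_le_mul_of_nonneg_right ?_ (star_mul_self_nonneg (x e))
    exact Complex.real_le_real.2 (pow_le_pow_left₀ (norm_nonneg _) h1 2)
  have h2 := CStarAlgebra.norm_le_norm_of_nonneg_of_le (E.preInner_self_nonneg _ v) h
  simpa using h2


lemma lact_add (E : TopologicalGraph E0 E1) (f : C₀(E0, ℂ)) (x y : C_c(E1, ℂ)) :
    E.lact f (x + y) = E.lact f x + E.lact f y := by
  ext e; exact mul_add _ _ _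

lemma lact_smul (E : TopologicalGraph E0 E1) (c : ℂ) (f : C₀(E0, ℂ)) (x : C_c(E1, ℂ)) :
    E.lact f (c • x) = c • E.lact f x := by
  ext e; exact mul_left_comm _ _ _

lemma add_lact (E : TopologicalGraph E0 E1) (f g : C₀(E0, ℂ)) (x : C_c(E1, ℂ)) :
    E.lact (f + g) x = E.lact f x + E.lact g x := by
  ext e; exact add_mul _ _ _

lemma smul_lact (E : TopologicalGraph E0 E1) (c : ℂ) (f : C₀(E0, ℂ)) (x : C_c(E1, ℂ)) :
    E.lact (c • f) x = c • E.lact f x := by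
  ext e; exact mul_assoc _ _ _

lemma mul_lact (E : TopologicalGraph E0 E1) (f g : C₀(E0, ℂ)) (x : C_c(E1, ℂ)) :
    E.lact (f * g) x = E.lact f (E.lact g x) := by
  ext e; exact mul_assoc _ _ _

lemma ract_add (E : TopologicalGraph E0 E1) (x : C_c(E1, ℂ)) (f g : C₀(E0, ℂ)) :
    E.ract x (f + g) = E.ract x f + E.ract x g := by
  ext e; exact mul_add _ _ _

lemma ract_smul (E : TopologicalGraph E0 E1) (c : ℂ) (x : C_c(E1, ℂ)) (f : C₀(E0, ℂ)) :
    E.ract x (c • f) = c • E.ract x f := by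
  ext e; exact mul_left_comm _ _ _

lemma add_ract (E : TopologicalGraph E0 E1) (x y : C_c(E1, ℂ)) (f : C₀(E0, ℂ)) :
    E.ract (x + y) f = E.ract x f + E.ract y f := by
  ext e; exact add_mul _ _ _

lemma smul_ract (E : TopologicalGraph E0 E1) (c : ℂ) (x : C_c(E1, ℂ)) (f : C₀(E0, ℂ)) :
    E.ract (c • x) f = c • E.ract x f := by
  ext e; exact mul_assoc _ _ _

lemma ract_mul (E : TopologicalGraph E0 E1) (x : C_c(E1, ℂ)) (f g : C₀(E0, ℂ)) :
    E.ract x (f * g) = E.ract (E.ract x f) g := by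
  ext e; exact (mul_assoc _ _ _).symm

/-- The underlying Banach space of the graph correspondence `X(E)`. -/
def Corr (E : TopologicalGraph E0 E1) : Type _ := UniformSpace.Completion E.PreCorr

instance (E : TopologicalGraph E0 E1) : NormedAddCommGroup E.Corr :=
  inferInstanceAs (NormedAddCommGroup (UniformSpace.Completion E.PreCorr))

instance (E : TopologicalGraph E0 E1) : NormedSpace ℂ E.Corr :=
  inferInstanceAs (NormedSpace ℂ (UniformSpace.Completion E.PreCorr))

instance (E : TopologicalGraph E0 E1) : CompleteSpace E.Corr :=
  inferInstanceAs (CompleteSpace (UniformSpace.Completion E.PreCorr))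

/-- The canonical isometry into the completion. -/
def toCompl (E : TopologicalGraph E0 E1) : E.PreCorr →ₗᵢ[ℂ] E.Corr :=
  (UniformSpace.Completion.toComplₗᵢ : E.PreCorr →ₗᵢ[ℂ] UniformSpace.Completion E.PreCorr)

/-- The canonical linear map `C_c(E¹) → X(E)`. -/
def toCorr (E : TopologicalGraph E0 E1) : C_c(E1, ℂ) →ₗ[ℂ] E.Corr :=
  E.toCompl.toLinearMap ∘ₗ E.toPre.toLinearMap

lemma norm_toCorr (E : TopologicalGraph E0 E1) (x : C_c(E1, ℂ)) :
    ‖E.toCorr x‖ = ‖E.toPre x‖ := E.toCompl.norm_map _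

lemma denseRange_toCompl (E : TopologicalGraph E0 E1) : DenseRange E.toCompl :=
  UniformSpace.Completion.denseRange_coe (α := E.PreCorr)

lemma denseRange_toCorr (E : TopologicalGraph E0 E1) : DenseRange E.toCorr :=
  E.denseRange_toCompl

/-- The inner product on `C_c(E¹)` as a bounded sesquilinear map. -/
def preIp (E : TopologicalGraph E0 E1) : E.PreCorr →L⋆[ℂ] E.PreCorr →L[ℂ] C₀(E0, ℂ) :=
  LinearMap.mkContinuous₂
    (LinearMap.mk₂'ₛₗ (starRingEnd ℂ) (RingHom.id ℂ)
      (fun x y => E.preInner (E.toPre.symm x) (E.toPre.symm y))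
      (fun x y z => by
        rw [map_add, ← star_preInner, preInner_add_right, star_add, star_preInner, star_preInner])
      (fun c x y => by
        rw [map_smul, ← star_preInner, preInner_smul_right, star_smul, star_preInner]; rfl)
      (fun x y z => by rw [map_add, preInner_add_right])
      (fun c x y => by rw [map_smul, preInner_smul_right]; rfl)) 1
    (fun x y => by
      rw [one_mul]
      exact E.norm_preInner_le (E.toPre.symm x) (E.toPre.symm y))

/-- The right action on `C_c(E¹)` as a bounded bilinear map. -/
def preRight (E : TopologicalGraph E0 E1) : E.PreCorr →L[ℂ] C₀(E0, ℂ) →L[ℂ] E.Corr :=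
  LinearMap.mkContinuous₂
    (LinearMap.mk₂ ℂ (fun x f => E.toCorr (E.ract (E.toPre.symm x) f))
      (fun x y f => by rw [map_add, add_ract, map_add])
      (fun c x f => by rw [map_smul, smul_ract, map_smul])
      (fun x f g => by rw [ract_add, map_add])
      (fun c x f => by rw [ract_smul, map_smul])) 1
    (fun x f => by
      rw [one_mul, mul_comm]
      exact (E.norm_toCorr _).trans_le (E.norm_ract_le (E.toPre.symm x) f))


/-- The left action on `C_c(E¹)` as a bounded bilinear map. -/
def preLeft (E : TopologicalGraph E0 E1) : E.PreCorr →L[ℂ] C₀(E0, ℂ) →L[ℂ] E.Corr :=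
  LinearMap.mkContinuous₂
    (LinearMap.mk₂ ℂ (fun x f => E.toCorr (E.lact f (E.toPre.symm x)))
      (fun x y f => by rw [map_add, lact_add, map_add])
      (fun c x f => by rw [map_smul, lact_smul, map_smul])
      (fun x f g => by rw [add_lact, map_add])
      (fun c x f => by rw [smul_lact, map_smul])) 1
    (fun x f => by
      rw [one_mul, mul_comm]
      exact (E.norm_toCorr _).trans_le (E.norm_lact_le f (E.toPre.symm x)))


/-- The extension to `X(E)` of a bounded (semi)linear map on `C_c(E¹)`. -/
def extendCorr (E : TopologicalGraph E0 E1) {σ : ℂ →+* ℂ} {F : Type*}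
    [NormedAddCommGroup F] [NormedSpace ℂ F] [CompleteSpace F] (T : E.PreCorr →SL[σ] F) :
    E.Corr →SL[σ] F :=
  T.extend E.toCompl.toContinuousLinearMap

/-- The `C₀(E⁰)`-valued inner product of `X(E)`, extended from `C_c(E¹)` by continuity. -/
def corrIp (E : TopologicalGraph E0 E1) : E.Corr →L⋆[ℂ] E.Corr →L[ℂ] C₀(E0, ℂ) :=
  (E.extendCorr (F := E.Corr →L⋆[ℂ] C₀(E0, ℂ))
    (E.extendCorr (F := E.PreCorr →L[ℂ] C₀(E0, ℂ)) E.preIp).flip).flip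

/-- The right action of `C₀(E⁰)` on `X(E)`, extended from `C_c(E¹)` by continuity. -/
def corrRight (E : TopologicalGraph E0 E1) : E.Corr →L[ℂ] C₀(E0, ℂ) →L[ℂ] E.Corr :=
  E.extendCorr (F := C₀(E0, ℂ) →L[ℂ] E.Corr) E.preRight

/-- The left action of `C₀(E⁰)` on `X(E)`, extended from `C_c(E¹)` by continuity. -/
def corrLeft (E : TopologicalGraph E0 E1) : C₀(E0, ℂ) →L[ℂ] E.Corr →L[ℂ] E.Corr :=
  (E.extendCorr (F := C₀(E0, ℂ) →L[ℂ] E.Corr) E.preLeft).flip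

lemma extendCorr_toCorr (E : TopologicalGraph E0 E1) {σ : ℂ →+* ℂ} {F : Type*}
    [NormedAddCommGroup F] [NormedSpace ℂ F] [CompleteSpace F] (T : E.PreCorr →SL[σ] F)
    (x : C_c(E1, ℂ)) :
    E.extendCorr T (E.toCorr x) = T (E.toPre x) :=
  T.extend_eq (e := E.toCompl.toContinuousLinearMap) E.denseRange_toCompl
    E.toCompl.isometry.isUniformInducing (E.toPre x)

lemma corrIp_toCorr (E : TopologicalGraph E0 E1) (x y : C_c(E1, ℂ)) :
    E.corrIp (E.toCorr x) (E.toCorr y) = E.preInner x y := by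
  unfold corrIp
  rw [ContinuousLinearMap.flip_apply, extendCorr_toCorr, ContinuousLinearMap.flip_apply, extendCorr_toCorr]
  rfl

lemma corrRight_toCorr (E : TopologicalGraph E0 E1) (x : C_c(E1, ℂ)) (f : C₀(E0, ℂ)) :
    E.corrRight (E.toCorr x) f = E.toCorr (E.ract x f) := by
  unfold corrRight
  rw [extendCorr_toCorr]
  rfl

lemma corrLeft_toCorr (E : TopologicalGraph E0 E1) (f : C₀(E0, ℂ)) (x : C_c(E1, ℂ)) :
    E.corrLeft f (E.toCorr x) = E.toCorr (E.lact f x) := by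
  unfold corrLeft
  rw [ContinuousLinearMap.flip_apply, extendCorr_toCorr]
  rfl

lemma norm_toCorr_sq (E : TopologicalGraph E0 E1) (x : C_c(E1, ℂ)) :
    ‖E.toCorr x‖ ^ 2 = ‖E.preInner x x‖ := by
  rw [← preCorr_norm_sq, norm_toCorr]

lemma corrIp_self_nonneg (E : TopologicalGraph E0 E1) (x : E.Corr) (v : E0) :
    0 ≤ E.corrIp x x v := by
  refine E.denseRange_toCorr.induction_on x ?_ fun y => ?_
  · have h : Continuous fun x => E.corrIp x x v := by
      have h1 : Continuous fun x => E.corrIp x x := by fun_prop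
      have h2 : Continuous fun f : C₀(E0, ℂ) => f v :=
        (LipschitzWith.of_dist_le_mul (K := 1) fun f g => by
          rw [dist_eq_norm, dist_eq_norm, NNReal.coe_one, one_mul]
          exact norm_apply_le (f - g) v).continuous
      exact h2.comp h1
    exact isClosed_le continuous_const h
  · rw [corrIp_toCorr]
    exact E.preInner_self_nonneg y v

/-- The graph correspondence `X(E)` over `C₀(E⁰)`. -/
def graphCorrespondence (E : TopologicalGraph E0 E1) :
    CStarCorrespondence C₀(E0, ℂ) E.Corr where
  ip := E.corrIp
  right := E.corrRight
  left :=
    { toFun := E.corrLeft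
      map_smul' := fun c f => by rw [map_smul]; rfl
      map_zero' := map_zero _
      map_add' := map_add _
      map_mul' := fun f g => by
        ext1 x
        change _ = E.corrLeft f (E.corrLeft g x)
        refine E.denseRange_toCorr.induction_on x (isClosed_eq (by fun_prop) (by fun_prop))
          fun y => ?_
        simp only [corrLeft_toCorr, mul_lact] }
  right_mul x a b := by
    refine E.denseRange_toCorr.induction_on x (isClosed_eq (by fun_prop) (by fun_prop))
      fun y => ?_
    simp only [corrRight_toCorr, ract_mul]
  ip_self_nonneg x := exists_sqrt _ (E.corrIp_self_nonneg x)
  norm_sq x := by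
    refine E.denseRange_toCorr.induction_on x (isClosed_eq (by fun_prop) (by fun_prop))
      fun y => ?_
    rw [corrIp_toCorr, norm_toCorr_sq]
  ip_right x y a := by
    refine E.denseRange_toCorr.induction_on₂ (isClosed_eq (by fun_prop) (by fun_prop))
      (fun x y => ?_) x y
    rw [corrRight_toCorr, corrIp_toCorr, corrIp_toCorr, preInner_ract]
  star_ip x y := by
    refine E.denseRange_toCorr.induction_on₂ (isClosed_eq (by fun_prop) (by fun_prop))
      (fun x y => ?_) x y
    rw [corrIp_toCorr, corrIp_toCorr, star_preInner]
  ip_left a x y := by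
    refine E.denseRange_toCorr.induction_on₂ (p := fun x y =>
        E.corrIp (E.corrLeft (star a) y) x = E.corrIp y (E.corrLeft a x))
      (isClosed_eq (by fun_prop) (by fun_prop)) (fun x y => ?_) x y
    rw [corrLeft_toCorr, corrLeft_toCorr, corrIp_toCorr, corrIp_toCorr, preInner_lact]

/-- `U` is an `s`-section: `s` restricts to a homeomorphism of `U` onto its image. -/
def IsSSection (E : TopologicalGraph E0 E1) (U : Set E1) : Prop := IsEmbedding (U.domRestrict E.s)

/-- `h` is the function `x̂`: `x̂(s(e)) = |x(e)|²` for `e` in the open support of `x`, and `x̂ = 0`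
outside the image of the open support under `s`. -/
def IsHat (E : TopologicalGraph E0 E1) (x : C_c(E1, ℂ)) (h : C₀(E0, ℂ)) : Prop :=
  (∀ e ∈ support x, h (E.s e) = ((‖x e‖ ^ 2 : ℝ) : ℂ)) ∧ ∀ v ∉ E.s '' support x, h v = 0

lemma IsSSection.injOn {E : TopologicalGraph E0 E1} {U : Set E1} (hU : E.IsSSection U) :
    InjOn E.s U :=
  injOn_iff_injective.2 hU.injective

lemma isHat_preInner (E : TopologicalGraph E0 E1) (x : C_c(E1, ℂ))
    (hx : E.IsSSection (support x)) : E.IsHat x (E.preInner x x) := by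
  have hsub : (support fun e => star (x e) * x e) ⊆ support x :=
    fun e he h0 => he (by change star (x e) * x e = 0; rw [h0, mul_zero])
  refine ⟨fun e he => ?_, fun v hv => ?_⟩
  · rw [preInner_apply, E.fiberSum_apply_of_injOn hx.injOn hsub he, Complex.star_def,
      Complex.conj_mul']
    push_cast
    rfl
  · exact E.fiberSum_eq_zero fun h => hv (image_mono hsub h)

/-- The vertices `E⁰_sce = E⁰ \ closure (r(E¹))`. -/
def sce (E : TopologicalGraph E0 E1) : Set E0 := (closure (range E.r))ᶜ

/-- The vertices `E⁰_fin` with a neighbourhood `N` such that `r⁻¹(N)` is compact. -/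
def fin (E : TopologicalGraph E0 E1) : Set E0 := {v | ∃ N ∈ 𝓝 v, IsCompact (E.r ⁻¹' N)}

/-- The regular vertices `E⁰_rg = E⁰_fin \ closure E⁰_sce`. -/
def rg (E : TopologicalGraph E0 E1) : Set E0 := E.fin \ closure E.sce

/-- `f` is a nonnegative element of `C_c(E⁰_rg)`, regarded as a subset of `C₀(E⁰)`. -/
structure IsNonnegCcRg (E : TopologicalGraph E0 E1) (f : C₀(E0, ℂ)) : Prop where
  hasCompactSupport : HasCompactSupport f
  tsupport_subset : tsupport f ⊆ E.rg
  nonneg : ∀ v, 0 ≤ f v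

/-- `𝒩` is a finite cover of `r⁻¹(supp f)` by open `s`-sections. -/
structure IsSSectionCover (E : TopologicalGraph E0 E1) (f : C₀(E0, ℂ)) (𝒩 : Finset (Set E1)) :
    Prop where
  isOpen : ∀ N ∈ 𝒩, IsOpen N
  isSSection : ∀ N ∈ 𝒩, E.IsSSection N
  cover : E.r ⁻¹' tsupport f ⊆ ⋃ N ∈ 𝒩, N

/-- The `g N`, for `N ∈ 𝒩`, are nonnegative, `{e | g N e ≠ 0} ⊆ N ∩ r⁻¹(supp f)`, and their sum is
`f ∘ r`. -/
structure IsPartition (E : TopologicalGraph E0 E1) (f : C₀(E0, ℂ)) (𝒩 : Finset (Set E1))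
    (g : Set E1 → C_c(E1, ℝ)) : Prop where
  nonneg : ∀ N ∈ 𝒩, ∀ e, 0 ≤ g N e
  support_subset : ∀ N ∈ 𝒩, support (g N) ⊆ N ∩ E.r ⁻¹' tsupport f
  sum_eq : ∀ e, ((∑ N ∈ 𝒩, g N e : ℝ) : ℂ) = f (E.r e)

/-- The function `√g`, as an element of `C_c(E¹)`. -/
def sqrtCc {X : Type*} [TopologicalSpace X] (g : C_c(X, ℝ)) : C_c(X, ℂ) where
  toFun e := ((√(g e) : ℝ) : ℂ)
  continuous_toFun := by fun_prop
  hasCompactSupport' := g.hasCompactSupport.comp_left (g := fun t : ℝ => ((√t : ℝ) : ℂ)) (by simp)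

variable {B : Type*} [NonUnitalCStarAlgebra B]

/-- Toeplitz representations of a topological graph in a C⋆-algebra. -/
structure IsToeplitzRep (E : TopologicalGraph E0 E1) (ψ : C_c(E1, ℂ) →ₗ[ℂ] B)
    (π : C₀(E0, ℂ) →⋆ₙₐ[ℂ] B) : Prop where
  map_lact : ∀ f x, ψ (E.lact f x) = π f * ψ x
  map_hat : ∀ (x : C_c(E1, ℂ)) (U : Set E1), IsOpen U → E.IsSSection U → tsupport x ⊆ U →
    ∀ h, E.IsHat x h → π h = star (ψ x) * ψ x
  star_mul_eq_zero : ∀ (x y : C_c(E1, ℂ)) (U V : Set E1), IsOpen U → IsOpen V →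
    E.IsSSection U → E.IsSSection V → Disjoint U V → tsupport x ⊆ U → tsupport y ⊆ V →
    star (ψ x) * ψ y = 0

/-- Covariant Toeplitz representations of a topological graph in a C⋆-algebra. -/
structure IsCovariantRep (E : TopologicalGraph E0 E1) (ψ : C_c(E1, ℂ) →ₗ[ℂ] B)
    (π : C₀(E0, ℂ) →⋆ₙₐ[ℂ] B) : Prop extends E.IsToeplitzRep ψ π where
  covariant : ∃ G : Set C₀(E0, ℂ), (∀ f ∈ G, E.IsNonnegCcRg f) ∧
    ((NonUnitalStarAlgebra.adjoin ℂ G).topologicalClosure : Set C₀(E0, ℂ)) =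
      {f | ∀ v ∉ E.rg, f v = 0} ∧
    ∀ f ∈ G, ∃ (𝒩 : Finset (Set E1)) (g : Set E1 → C_c(E1, ℝ)),
      E.IsSSectionCover f 𝒩 ∧ E.IsPartition f 𝒩 g ∧
      π f = ∑ N ∈ 𝒩, ψ (sqrtCc (g N)) * star (ψ (sqrtCc (g N)))

end TopologicalGraph

end

noncomputable section

open Topology Set Function Filter

set_option linter.unusedSectionVars false

/-! ### Adjoints of finite sums of rank-one operators. -/

namespace CStarCorrespondence

variable {A X B : Type*} [NonUnitalCStarAlgebra A] [NormedAddCommGroup X] [NormedSpace ℂ X]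
  [CompleteSpace X] [NonUnitalCStarAlgebra B]

/-! The Toeplitz relation `ψ(x)^* ψ(y) = π(⟨x, y⟩)` is local. The difference of its two sides is
sesquilinear, and the axioms make it vanish for `x = y` supported in an open `s`-section and for
`x`, `y` supported in disjoint open `s`-sections. Polarization and partitions of unity spread this
to all of `C_c(E¹)` (`IsToeplitzRep.star_mul`). Hence `ψ` is contractive and extends to `X(E)`.

Let `D` be the closed span of the elements `ψ(x) ψ(y)^*`. Everything about covariance rests on one
rigidity fact: an element of `D` is determined by its left multiplication on `ψ(X)`
(`Implements.unique`). Together with a norm estimate this constructs `ψ⁽¹⁾`: its value at a compact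
`T` is the unique element of `D` acting on `ψ(X)` as `T`. Since `π(a)` always acts on `ψ(X)` as
`φ(a)`, the identity `ψ⁽¹⁾(φ(a)) = π(a)` amounts to `π(a) ∈ D`.

Covariance on a generating set places `π(C₀(E⁰_rg))` inside `D`, because `D` is a closed
`*`-subalgebra. It remains to see that `a` vanishes off `E⁰_rg` when `φ(a)` is compact and `a ⊥ ker
φ`: compactness confines the support to `E⁰_fin`, and orthogonality kills `a` on the closure of
`E⁰_sce` (`eq_zero_of_notMem_rg`). The formula for an arbitrary compatible partition is rigidity
again: both sides lie in `D` and act on `ψ(X)` as `φ(f)`. -/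

lemma IsAdjointOf.symm {C : CStarCorrespondence A X} {S T : X →L[ℂ] X}
    (h : C.IsAdjointOf S T) : C.IsAdjointOf T S := fun x y => by
  rw [← C.star_ip, ← h, C.star_ip]

lemma isAdjointOf_theta (C : CStarCorrespondence A X) (x y : X) :
    C.IsAdjointOf (C.theta y x) (C.theta x y) := fun u v => by
  have h1 : C.ip (C.right y (C.ip x v)) u = star (C.ip u y * C.ip x v) := by
    rw [← C.ip_right, C.star_ip]
  change C.ip (C.right y (C.ip x v)) u = C.ip v (C.right x (C.ip y u))
  rw [h1, star_mul, C.star_ip, C.star_ip, C.ip_right]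

lemma exists_adjoint_of_mem_span (C : CStarCorrespondence A X) {T : X →L[ℂ] X}
    (hT : T ∈ Submodule.span ℂ (range (uncurry C.theta))) : ∃ S, C.IsAdjointOf S T := by
  induction hT using Submodule.span_induction with
  | mem T h =>
    obtain ⟨⟨x, y⟩, rfl⟩ := h
    exact ⟨_, C.isAdjointOf_theta x y⟩
  | zero => exact ⟨0, fun x y => by simp⟩
  | add T T' _ _ h h' =>
    obtain ⟨S, hS⟩ := h
    obtain ⟨S', hS'⟩ := h'
    exact ⟨S + S', fun x y => by simp [hS x y, hS' x y]⟩
  | smul c T _ h =>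
    obtain ⟨S, hS⟩ := h
    exact ⟨star c • S, fun x y => by simp [hS x y]⟩

/-- Comes from `‖S y‖² = ‖⟨y, T S y⟩‖` after cancelling `‖S y‖`. The optimal constant 1 is not
needed; any bound independent of `T` suffices. -/
lemma IsAdjointOf.norm_le {C : CStarCorrespondence A X} {S T : X →L[ℂ] X}
    (h : C.IsAdjointOf S T) : ‖S‖ ≤ ‖C.ip‖ * ‖T‖ := by
  refine S.opNorm_le_bound (by positivity) fun y => ?_
  by_cases h0 : ‖S y‖ = 0
  · rw [h0]; positivity
  have h1 : ‖S y‖ * ‖S y‖ ≤ ‖C.ip‖ * ‖T‖ * ‖y‖ * ‖S y‖ := by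
    calc ‖S y‖ * ‖S y‖ = ‖C.ip y (T (S y))‖ := by rw [← sq, C.norm_sq, h]
      _ ≤ ‖C.ip‖ * ‖y‖ * ‖T (S y)‖ := C.ip.le_opNorm₂ _ _
      _ ≤ ‖C.ip‖ * ‖y‖ * (‖T‖ * ‖S y‖) := by gcongr; exact T.le_opNorm _
      _ = _ := by ring
  exact le_of_mul_le_mul_right h1 (lt_of_le_of_ne (norm_nonneg _) (Ne.symm h0))

/-! ### The algebra spanned by `ψ(x) ψ(y)^*` and the homomorphism `ψ⁽¹⁾`. -/

namespace IsToeplitzRep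

variable {C : CStarCorrespondence A X} {ψ : X →L[ℂ] B} {π : A →⋆ₙₐ[ℂ] B}

/-- With `d` the difference of the two sides, all four terms of `d^* d` equal `π(a)^* π(⟨x, x⟩)
π(a)` up to sign, so they cancel. -/
lemma map_right (h : C.IsToeplitzRep (ψ : X →ₗ[ℂ] B) π) (x : X) (a : A) :
    ψ (C.right x a) = ψ x * π a := by
  have hs : ∀ x y, star (ψ x) * ψ y = π (C.ip x y) := h.star_mul
  have h1 : ∀ y, C.ip (C.right x a) y = star a * C.ip x y := fun y => by
    rw [← C.star_ip, C.ip_right, StarMul.star_mul, C.star_ip]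
  rw [← sub_eq_zero, ← CStarRing.star_mul_self_eq_zero_iff]
  simp only [star_sub, StarMul.star_mul, sub_mul, mul_sub]
  have e1 : star (ψ (C.right x a)) * (ψ x * π a) = star (π a) * π (C.ip x x) * π a := by
    rw [← mul_assoc, hs, h1, map_mul, map_star]
  have e2 : star (π a) * star (ψ x) * ψ (C.right x a) = star (π a) * π (C.ip x x) * π a := by
    rw [mul_assoc, hs, C.ip_right, map_mul, mul_assoc]
  have e3 : star (π a) * star (ψ x) * (ψ x * π a) = star (π a) * π (C.ip x x) * π a := by
    rw [mul_assoc, ← mul_assoc (star (ψ x)), hs, mul_assoc]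
  have e4 : star (ψ (C.right x a)) * ψ (C.right x a) = star (π a) * π (C.ip x x) * π a := by
    rw [hs, C.ip_right, h1, map_mul, map_mul, map_star]
  rw [e1, e2, e3, e4]
  simp

/-- The linear span of the elements `ψ(x) ψ(y)^*`. -/
def rankOneSpan (h : C.IsToeplitzRep (ψ : X →ₗ[ℂ] B) π) : NonUnitalStarSubalgebra ℂ B where
  toSubmodule := Submodule.span ℂ (range fun p : X × X => ψ p.1 * star (ψ p.2))
  mul_mem' := by
    intro a b ha hb
    change a * b ∈ Submodule.span ℂ _
    refine Submodule.span_induction₂ (p := fun a b _ _ => a * b ∈ Submodule.span ℂ _) ?_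
      (by simp) (by simp) (fun _ _ _ _ _ _ h1 h2 => by rw [add_mul]; exact add_mem h1 h2)
      (fun _ _ _ _ _ _ h1 h2 => by rw [mul_add]; exact add_mem h1 h2)
      (fun c _ _ _ _ h1 => by rw [smul_mul_assoc]; exact Submodule.smul_mem _ c h1)
      (fun c _ _ _ _ h1 => by rw [mul_smul_comm]; exact Submodule.smul_mem _ c h1) ha hb
    rintro _ _ ⟨⟨x, y⟩, rfl⟩ ⟨⟨u, v⟩, rfl⟩
    -- The same pair as in `Θ_{x,y} Θ_{u,v} = Θ_{x·⟨y,u⟩, v}`.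
    refine Submodule.subset_span ⟨(C.right x (C.ip y u), v), ?_⟩
    have hs : star (ψ y) * ψ u = π (C.ip y u) := h.star_mul y u
    simp only [h.map_right, ← hs, mul_assoc]
  star_mem' := by
    intro a ha
    change star a ∈ Submodule.span ℂ _
    replace ha : a ∈ Submodule.span ℂ (range fun p : X × X => ψ p.1 * star (ψ p.2)) := ha
    induction ha using Submodule.span_induction with
    | mem _ hx =>
      obtain ⟨⟨x, y⟩, rfl⟩ := hx
      exact Submodule.subset_span ⟨(y, x), by simp⟩
    | zero => simp
    | add _ _ _ _ h1 h2 => rw [star_add]; exact add_mem h1 h2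
    | smul c _ _ h1 => rw [star_smul]; exact Submodule.smul_mem _ _ h1

/-- The closed linear span of the elements `ψ(x) ψ(y)^*`. -/
def rankOneClosure (h : C.IsToeplitzRep (ψ : X →ₗ[ℂ] B) π) : NonUnitalStarSubalgebra ℂ B :=
  h.rankOneSpan.topologicalClosure

lemma mul_star_mem (h : C.IsToeplitzRep (ψ : X →ₗ[ℂ] B) π) (x y : X) :
    ψ x * star (ψ y) ∈ h.rankOneClosure :=
  subset_closure (Submodule.subset_span ⟨(x, y), rfl⟩)

lemma mul_eq_zero_of_mem (h : C.IsToeplitzRep (ψ : X →ₗ[ℂ] B) π) {b d : B}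
    (hd : d ∈ h.rankOneClosure) (hb : ∀ x y, ψ x * star (ψ y) * b = 0) : d * b = 0 := by
  have hcl : IsClosed {d : B | d * b = 0} := isClosed_eq (by fun_prop) continuous_const
  refine closure_minimal (fun d hd => ?_) hcl hd
  replace hd : d ∈ Submodule.span ℂ (range fun p : X × X => ψ p.1 * star (ψ p.2)) := hd
  change d * b = 0
  induction hd using Submodule.span_induction with
  | mem _ hx => obtain ⟨⟨x, y⟩, rfl⟩ := hx; exact hb x y
  | zero => simp
  | add _ _ _ _ h1 h2 => rw [add_mul, h1, h2, add_zero]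
  | smul c _ _ h1 => rw [smul_mul_assoc, h1, smul_zero]

/-- `b` belongs to the closed span of the `ψ(x) ψ(y)^*` and acts on `ψ(X)` as `T` acts on `X`. -/
structure Implements (h : C.IsToeplitzRep (ψ : X →ₗ[ℂ] B) π) (b : B) (T : X →L[ℂ] X) : Prop where
  mem : b ∈ h.rankOneClosure
  mul_apply : ∀ z, b * ψ z = ψ (T z)

variable {h : C.IsToeplitzRep (ψ : X →ₗ[ℂ] B) π}

namespace Implements

variable {b b' : B} {S T : X →L[ℂ] X}

/-- The difference `c` satisfies `c ψ(y) = 0`, so `ψ(x) ψ(y)^* c^* = ψ(x) (c ψ(y))^* = 0`. Thus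
`c^*` is annihilated from the left by the whole closed span, in particular by `c`, and `c c^* = 0`.
-/
lemma unique (hb : h.Implements b T) (hb' : h.Implements b' T) : b = b' := by
  have hmem : b - b' ∈ h.rankOneClosure := sub_mem hb.mem hb'.mem
  rw [← sub_eq_zero, ← star_eq_zero, ← CStarRing.star_mul_self_eq_zero_iff, star_star,
    ← star_eq_zero, StarMul.star_mul, star_star]
  have h1 : ∀ z, (b - b') * ψ z = 0 := fun z => by
    rw [sub_mul, hb.mul_apply, hb'.mul_apply, sub_self]
  have h2 := h.mul_eq_zero_of_mem (b := star (b - b')) hmem fun x y => by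
    rw [← star_eq_zero]
    simp only [StarMul.star_mul, star_star, ← mul_assoc, h1, zero_mul]
  exact h2

lemma theta (h : C.IsToeplitzRep (ψ : X →ₗ[ℂ] B) π) (x y : X) :
    h.Implements (ψ x * star (ψ y)) (C.theta x y) where
  mem := h.mul_star_mem x y
  mul_apply z := by
    have hs : star (ψ y) * ψ z = π (C.ip y z) := h.star_mul y z
    rw [mul_assoc, hs, ← h.map_right]
    rfl

lemma zero (h : C.IsToeplitzRep (ψ : X →ₗ[ℂ] B) π) : h.Implements 0 0 where
  mem := zero_mem _
  mul_apply z := by simp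

lemma add (hb : h.Implements b T) (hb' : h.Implements b' S) : h.Implements (b + b') (T + S) where
  mem := add_mem hb.mem hb'.mem
  mul_apply z := by simp [add_mul, hb.mul_apply, hb'.mul_apply]

lemma smul (c : ℂ) (hb : h.Implements b T) : h.Implements (c • b) (c • T) where
  mem := SMulMemClass.smul_mem c hb.mem
  mul_apply z := by simp [smul_mul_assoc, hb.mul_apply]

lemma mul (hb : h.Implements b T) (hb' : h.Implements b' S) : h.Implements (b * b') (T * S) where
  mem := mul_mem hb.mem hb'.mem
  mul_apply z := by rw [mul_assoc, hb'.mul_apply, hb.mul_apply]; rfl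

/-- The error `d = b^* ψ(z) - ψ(S z)` satisfies `ψ(w)^* d = 0` for every `w`, by adjointness. Since
`b` is a limit of sums of `ψ(x) ψ(y)^*`, also `b d = 0`, and both terms of `d^* d` vanish. -/
lemma adjoint (hb : h.Implements b T) (hST : C.IsAdjointOf S T) : h.Implements (star b) S where
  mem := star_mem hb.mem
  mul_apply z := by
    have hs : ∀ x y, star (ψ x) * ψ y = π (C.ip x y) := h.star_mul
    have h1 : ∀ w, star (ψ w) * (star b * ψ z - ψ (S z)) = 0 := fun w => by
      rw [mul_sub, ← mul_assoc, ← StarMul.star_mul, hb.mul_apply, hs, hs, hST.symm, sub_self]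
    have h2 := h.mul_eq_zero_of_mem (b := star b * ψ z - ψ (S z)) hb.mem fun x y => by
      rw [mul_assoc, h1, mul_zero]
    rw [← sub_eq_zero, ← CStarRing.star_mul_self_eq_zero_iff, star_sub, StarMul.star_mul, star_star,
      sub_mul, mul_assoc, h1, h2, mul_zero, sub_zero]

end Implements

/-- An element of the span of the `ψ(x) ψ(y)^*` is the value at `1` of a bounded linear map
intertwining composition of operators with multiplication of their implementations. -/
lemma exists_amplification (h : C.IsToeplitzRep (ψ : X →ₗ[ℂ] B) π) {c : B}
    (hc : c ∈ h.rankOneSpan) :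
    ∃ F : (X →L[ℂ] X) →L[ℂ] B, F 1 = c ∧
      ∀ (d : B) (S : X →L[ℂ] X), (∀ z, d * ψ z = ψ (S z)) → ∀ R, d * F R = F (S * R) := by
  replace hc : c ∈ Submodule.span ℂ (range fun p : X × X => ψ p.1 * star (ψ p.2)) := hc
  induction hc using Submodule.span_induction with
  | mem _ hx =>
    obtain ⟨⟨x, y⟩, rfl⟩ := hx
    -- For a generator the map is `R ↦ ψ(R x) ψ(y)^*`.
    refine ⟨((ContinuousLinearMap.mul ℂ B).flip (star (ψ y))).comp
      (ψ.comp (ContinuousLinearMap.apply ℂ X x)), by simp, fun d S hd R => ?_⟩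
    simp [← mul_assoc, hd]
  | zero => exact ⟨0, by simp, by simp⟩
  | add _ _ _ _ h1 h2 =>
    obtain ⟨F, hF, hF'⟩ := h1
    obtain ⟨G, hG, hG'⟩ := h2
    refine ⟨F + G, by simp [hF, hG], fun d S hd R => ?_⟩
    simp [mul_add, hF' d S hd, hG' d S hd]
  | smul c _ _ h1 =>
    obtain ⟨F, hF, hF'⟩ := h1
    refine ⟨c • F, by simp [hF], fun d S hd R => ?_⟩
    simp [mul_smul_comm, hF' d S hd]

/-- A spectral radius argument. The amplification gives `c ^ (m + 1) = F (S ^ m)`, so powers of `c`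
grow no faster than powers of `S` up to the constant `‖F‖`. Self-adjointness gives `‖c ^ n‖ = ‖c‖ ^
n` for `n` a power of two, and the constant disappears in the limit. -/
lemma norm_le_of_isSelfAdjoint (h : C.IsToeplitzRep (ψ : X →ₗ[ℂ] B) π) {c : B}
    (hc : c ∈ h.rankOneSpan) (hsa : IsSelfAdjoint c) {S : X →L[ℂ] X}
    (hS : ∀ z, c * ψ z = ψ (S z)) : ‖c‖ ≤ ‖S‖ := by
  obtain ⟨F, hF, hF'⟩ := h.exists_amplification hc
  have hpow : ∀ m : ℕ, (c : Unitization ℂ B) ^ (m + 1) = (F (S ^ m) : B) := by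
    intro m
    induction m with
    | zero => simp [hF]
    | succ m ih => rw [pow_succ', ih, ← Unitization.inr_mul, hF' c S hS, ← pow_succ']
  have hle : ∀ k : ℕ, ‖c‖ ^ (2 ^ (k + 1)) ≤ ‖F‖ * ‖S‖ ^ (2 ^ (k + 1) - 1) := by
    intro k
    have hsa' : IsSelfAdjoint (c : Unitization ℂ B) := by
      rw [IsSelfAdjoint, ← Unitization.inr_star, hsa.star_eq]
    -- The exponent is at least 2, so the power of `S` that remains is positive and no bound on
    -- `‖1‖` enters.
    have h2 : 1 < 2 ^ (k + 1) := Nat.one_lt_two_pow (by simp)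
    have h1 := hsa'.norm_pow_two_pow (k + 1)
    rw [Unitization.norm_inr] at h1
    rw [← h1, ← Nat.sub_add_cancel h2.le, hpow, Unitization.norm_inr, Nat.add_sub_cancel]
    refine (F.le_opNorm _).trans ?_
    gcongr
    exact norm_pow_le' S (by omega)
  by_contra! hlt
  have hpos : 0 < ‖c‖ := (norm_nonneg S).trans_lt hlt
  -- Dividing `hle` by `‖c‖ ^ (2 ^ (k + 1) - 1)` bounds `‖c‖` by this sequence, which tends to 0 if
  -- `‖S‖ < ‖c‖`.
  have ht : Tendsto (fun k : ℕ => ‖F‖ * (‖S‖ / ‖c‖) ^ (2 ^ (k + 1) - 1)) atTop (𝓝 (‖F‖ * 0)) := by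
    refine Tendsto.const_mul _ ((tendsto_pow_atTop_nhds_zero_of_lt_one (by positivity)
      ((div_lt_one hpos).2 hlt)).comp ?_)
    refine tendsto_atTop_mono (fun k => ?_) tendsto_id
    have := Nat.lt_two_pow_self (n := k + 1)
    simp only [id]
    omega
  rw [mul_zero] at ht
  refine absurd (ge_of_tendsto' ht fun k => ?_) (not_le.2 hpos)
  rw [div_pow, ← mul_div_assoc, le_div_iff₀ (by positivity), ← pow_succ',
    Nat.sub_add_cancel Nat.one_le_two_pow]
  exact hle k

/-- Reduces to the self-adjoint case: `b^* b` implements `S T`, and `‖b‖² = ‖b^* b‖`. -/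
lemma Implements.norm_le (h : C.IsToeplitzRep (ψ : X →ₗ[ℂ] B) π) {b : B} {S T : X →L[ℂ] X}
    (hb : b ∈ h.rankOneSpan) (hbT : ∀ z, b * ψ z = ψ (T z)) (hST : C.IsAdjointOf S T) :
    ‖b‖ ≤ √‖C.ip‖ * ‖T‖ := by
  have himp : h.Implements b T := ⟨subset_closure hb, hbT⟩
  have h1 : ‖star b * b‖ ≤ ‖S * T‖ :=
    h.norm_le_of_isSelfAdjoint (mul_mem (star_mem hb) hb) (.star_mul_self b)
      ((himp.adjoint hST).mul himp).mul_apply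
  rw [CStarRing.norm_star_mul_self] at h1
  refine abs_le_of_sq_le_sq' ?_ (by positivity) |>.2
  calc ‖b‖ ^ 2 = ‖b‖ * ‖b‖ := sq _
    _ ≤ ‖S‖ * ‖T‖ := h1.trans (norm_mul_le S T)
    _ ≤ ‖C.ip‖ * ‖T‖ * ‖T‖ := by gcongr; exact hST.norm_le
    _ = (√‖C.ip‖ * ‖T‖) ^ 2 := by rw [mul_pow, Real.sq_sqrt (by positivity)]; ring

lemma exists_implements_of_mem_span (h : C.IsToeplitzRep (ψ : X →ₗ[ℂ] B) π) {T : X →L[ℂ] X}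
    (hT : T ∈ Submodule.span ℂ (range (uncurry C.theta))) :
    ∃ b ∈ h.rankOneSpan, ∀ z, b * ψ z = ψ (T z) := by
  induction hT using Submodule.span_induction with
  | mem T hT =>
    obtain ⟨⟨x, y⟩, rfl⟩ := hT
    exact ⟨_, Submodule.subset_span ⟨(x, y), rfl⟩, (Implements.theta h x y).mul_apply⟩
  | zero => exact ⟨0, zero_mem _, by simp⟩
  | add _ _ _ _ h1 h2 =>
    obtain ⟨b, hb, hb'⟩ := h1
    obtain ⟨d, hd, hd'⟩ := h2
    exact ⟨b + d, add_mem hb hd, fun z => by simp [add_mul, hb', hd']⟩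
  | smul c _ _ h1 =>
    obtain ⟨b, hb, hb'⟩ := h1
    exact ⟨c • b, SMulMemClass.smul_mem c hb, fun z => by simp [smul_mul_assoc, hb']⟩

/-- Approximating `T` by finite sums of rank-one operators, the implementing elements form a Cauchy
sequence, because the norm estimate has a constant depending only on the correspondence; their limit
implements `T`. -/
lemma exists_implements (h : C.IsToeplitzRep (ψ : X →ₗ[ℂ] B) π) (T : C.compacts) :
    ∃ b, h.Implements b T := by
  obtain ⟨t, ht, htT⟩ := mem_closure_iff_seq_limit.1
    (show (T : X →L[ℂ] X) ∈ closure (Submodule.span ℂ (range (uncurry C.theta)) : Set _) from T.2)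
  choose b hb hbt using fun n => h.exists_implements_of_mem_span (ht n)
  have hcauchy : CauchySeq b := by
    have hle : ∀ m n, dist (b m) (b n) ≤ √‖C.ip‖ * dist (t m) (t n) := fun m n => by
      obtain ⟨S, hS⟩ := C.exists_adjoint_of_mem_span (sub_mem (ht m) (ht n))
      rw [dist_eq_norm, dist_eq_norm]
      exact Implements.norm_le h (sub_mem (hb m) (hb n))
        (fun z => by rw [sub_mul, hbt, hbt, ← map_sub]; rfl) hS
    rw [cauchySeq_iff_tendsto_dist_atTop_0]
    have ht0 := (cauchySeq_iff_tendsto_dist_atTop_0.1 htT.cauchySeq).const_mul √‖C.ip‖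
    rw [mul_zero] at ht0
    exact squeeze_zero (fun _ => dist_nonneg) (fun p => hle p.1 p.2) ht0
  obtain ⟨c, hc⟩ := cauchySeq_tendsto_of_complete hcauchy
  refine ⟨c, mem_closure_of_tendsto hc (Eventually.of_forall hb), fun z => ?_⟩
  refine tendsto_nhds_unique (hc.mul_const (ψ z)) ?_
  simp only [hbt]
  exact (ψ.continuous.tendsto _).comp
    (((ContinuousLinearMap.apply ℂ X z).continuous.tendsto (T : X →L[ℂ] X)).comp htT)

lemma exists_isInducedHom (h : C.IsToeplitzRep (ψ : X →ₗ[ℂ] B) π) :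
    ∃ ψ₁ : C.compacts →ₙₐ[ℂ] B, C.IsInducedHom (ψ : X →ₗ[ℂ] B) ψ₁ ∧
      ∀ (T : C.compacts) (b : B), h.Implements b T → ψ₁ T = b := by
  choose f hf using h.exists_implements
  refine ⟨{ toFun := f
            map_smul' := fun c T => (hf _).unique ((hf T).smul c)
            map_zero' := (hf _).unique (Implements.zero h)
            map_add' := fun S T => (hf _).unique ((hf S).add (hf T))
            map_mul' := fun S T => (hf _).unique ((hf S).mul (hf T)) }, ⟨fun S T hST => ?_,
    fun x y => ?_⟩, fun T b hb => (hf T).unique hb⟩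
  · exact (hf S).unique ((hf T).adjoint hST)
  · exact (hf _).unique (Implements.theta h x y)

/-- The left-action relation already says that `π(a)` acts on `ψ(X)` as `φ(a)`; membership in the
closed span is all that is missing for `π(a)` to be the value of `ψ⁽¹⁾`. -/
lemma isCovariantRep (h : C.IsToeplitzRep (ψ : X →ₗ[ℂ] B) π)
    (hπ : ∀ a, C.left a ∈ C.compacts → (∀ b, C.left b = 0 → a * b = 0) → π a ∈ h.rankOneClosure) :
    C.IsCovariantRep (ψ : X →ₗ[ℂ] B) π := by
  obtain ⟨ψ₁, h1, h2⟩ := h.exists_isInducedHom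
  exact ⟨h, ψ₁, h1, fun a ha hker => h2 _ _ ⟨hπ a ha hker, fun z => (h.map_left a z).symm⟩⟩

end IsToeplitzRep

end CStarCorrespondence

/-! ### Partitions of unity and polarization. -/

/-- A compactly supported function is a finite sum of functions subordinate to a given family of
open neighbourhoods. -/
lemma CompactlySupportedContinuousMap.exists_eq_sum_tsupport_subset {X : Type*}
    [TopologicalSpace X] [T2Space X] [LocallyCompactSpace X] (x : C_c(X, ℂ)) {U : X → Set X}
    (hU : ∀ e, IsOpen (U e)) (hmem : ∀ e, e ∈ U e) :
    ∃ (n : ℕ) (a : Fin n → X) (z : Fin n → C_c(X, ℂ)),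
      x = ∑ i, z i ∧ ∀ i, tsupport (z i) ⊆ U (a i) := by
  obtain ⟨t, ht⟩ := x.hasCompactSupport.isCompact.elim_finite_subcover U hU
    fun e _ => mem_iUnion.2 ⟨e, hmem e⟩
  let ι := t.equivFin
  obtain ⟨h, h1, h2, -, -⟩ := exists_continuous_sum_one_of_isOpen_isCompact
    (s := fun i => U (ι.symm i)) (fun i => hU _) x.hasCompactSupport.isCompact (by
      intro e he
      obtain ⟨a, ha, hea⟩ := mem_iUnion₂.1 (ht he)
      exact mem_iUnion.2 ⟨ι ⟨a, ha⟩, by simpa using hea⟩)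
  refine ⟨_, fun i => ι.symm i, fun i => ⟨⟨fun e => (h i e : ℂ) * x e, by fun_prop⟩,
    x.hasCompactSupport.mul_left⟩, ?_, fun i => ?_⟩
  · ext e
    rw [CompactlySupportedContinuousMap.sum_apply]
    change x e = ∑ i, (h i e : ℂ) * x e
    by_cases he : e ∈ tsupport x
    · have := h2 he
      simp only [Finset.sum_apply, Pi.one_apply] at this
      rw [← Finset.sum_mul, ← Complex.ofReal_sum, this]
      simp
    · simp [image_eq_zero_of_notMem_tsupport he]
  · change tsupport (fun e => (h i e : ℂ) * x e) ⊆ _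
    refine (closure_mono ?_).trans (h1 i)
    intro e he h0
    exact he (by simp [h0])

/-- Polarization: `x + y` gives `F y x = -F x y`, and `x + i y` then gives `2 i F x y = 0`. -/
lemma LinearMap.eq_zero_of_forall_self {V B : Type*} [AddCommGroup V] [Module ℂ V]
    [AddCommGroup B] [Module ℂ B] (F : V →ₗ⋆[ℂ] V →ₗ[ℂ] B) {p : Submodule ℂ V}
    (h : ∀ x ∈ p, F x x = 0) {x y : V} (hx : x ∈ p) (hy : y ∈ p) : F x y = 0 := by
  have h1 := h _ (add_mem hx hy)
  have h2 := h _ (add_mem hx (p.smul_mem Complex.I hy))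
  simp only [map_add, LinearMap.add_apply, LinearMap.map_smulₛₗ, LinearMap.smul_apply,
    h x hx, h y hy, map_smul, Complex.conj_I, zero_add, add_zero, smul_zero]
    at h1 h2
  have h3 : F y x = - F x y := by rw [eq_neg_iff_add_eq_zero, ← h1]
  rw [h3, smul_neg, neg_smul, neg_neg, ← two_smul ℂ, smul_smul] at h2
  exact (smul_eq_zero.1 h2).resolve_left (by simp)

/-! ### From the graph relations to a Toeplitz representation of `X(E)`. -/

namespace TopologicalGraph

variable {E0 E1 : Type*} [TopologicalSpace E0] [TopologicalSpace E1] [T2Space E0] [T2Space E1]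
  [LocallyCompactSpace E1]

lemma IsSSection.mono {E : TopologicalGraph E0 E1} {U V : Set E1} (hU : E.IsSSection U)
    (h : V ⊆ U) : E.IsSSection V :=
  IsEmbedding.comp (g := U.domRestrict E.s) hU (IsEmbedding.inclusion h)

lemma exists_isOpen_isSSection (E : TopologicalGraph E0 E1) (e : E1) :
    ∃ U, IsOpen U ∧ e ∈ U ∧ E.IsSSection U := by
  obtain ⟨φ, he, hφ⟩ := E.isLocalHomeomorph_s e
  refine ⟨φ.source, φ.open_source, he, ?_⟩
  refine IsOpenEmbedding.isEmbedding (IsLocalHomeomorph.isOpenEmbedding_of_injective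
    (E.isLocalHomeomorph_s.comp φ.open_source.isOpenEmbedding_subtypeVal.isLocalHomeomorph) ?_)
  rw [hφ]
  exact injOn_iff_injective.1 φ.injOn

variable {B : Type*} [NonUnitalCStarAlgebra B]

/-- The sesquilinear map `ψ(x)^* ψ(y) - π(⟨x, y⟩)`. -/
def toeplitzDefect (E : TopologicalGraph E0 E1) (ψ : C_c(E1, ℂ) →ₗ[ℂ] B)
    (π : C₀(E0, ℂ) →⋆ₙₐ[ℂ] B) : C_c(E1, ℂ) →ₗ⋆[ℂ] C_c(E1, ℂ) →ₗ[ℂ] B :=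
  LinearMap.mk₂'ₛₗ (starRingEnd ℂ) (RingHom.id ℂ)
    (fun x y => star (ψ x) * ψ y - π (E.preInner x y))
    (fun x y z => by
      rw [← star_preInner, preInner_add_right, star_add, star_preInner, star_preInner, map_add,
        map_add, star_add, add_mul]
      abel)
    (fun c x y => by
      rw [← star_preInner, preInner_smul_right, star_smul, star_preInner, map_smul, map_smul,
        star_smul, smul_mul_assoc, ← smul_sub]
      rfl)
    (fun x y z => by rw [preInner_add_right, map_add, map_add, mul_add]; abel)
    (fun c x y => by
      rw [preInner_smul_right, map_smul, map_smul, mul_smul_comm, ← smul_sub]; rfl)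

lemma toeplitzDefect_apply (E : TopologicalGraph E0 E1) (ψ : C_c(E1, ℂ) →ₗ[ℂ] B)
    (π : C₀(E0, ℂ) →⋆ₙₐ[ℂ] B) (x y : C_c(E1, ℂ)) :
    E.toeplitzDefect ψ π x y = star (ψ x) * ψ y - π (E.preInner x y) := rfl

/-- The functions of `C_c(E¹)` with support in `U`. -/
def supportedIn (U : Set E1) : Submodule ℂ C_c(E1, ℂ) where
  carrier := {x | tsupport x ⊆ U}
  zero_mem' := by
    change tsupport (fun _ : E1 => (0 : ℂ)) ⊆ U
    simp
  add_mem' {x y} hx hy := (tsupport_add x y).trans (union_subset hx hy)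
  smul_mem' c x hx :=
    (closure_mono (support_const_smul_subset c (x : E1 → ℂ))).trans hx

lemma preInner_eq_zero_of_disjoint (E : TopologicalGraph E0 E1) {x y : C_c(E1, ℂ)}
    (h : Disjoint (tsupport x) (tsupport y)) : E.preInner x y = 0 := by
  ext v
  rw [preInner_apply]
  refine E.fiberSum_eq_zero ?_
  rintro ⟨e, he, -⟩
  refine he ?_
  by_cases hx : e ∈ tsupport x
  · simp [image_eq_zero_of_notMem_tsupport (disjoint_left.1 h hx)]
  · simp [image_eq_zero_of_notMem_tsupport hx]

/-- The defect vanishes for `x`, `y` supported near any given pair of edges: polarization handles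
equal edges, and disjoint `s`-sections handle distinct ones. Finite decompositions of `y` and then
of `x` assemble the general case. -/
lemma IsToeplitzRep.star_mul {E : TopologicalGraph E0 E1} {ψ : C_c(E1, ℂ) →ₗ[ℂ] B}
    {π : C₀(E0, ℂ) →⋆ₙₐ[ℂ] B} (h : E.IsToeplitzRep ψ π) (x y : C_c(E1, ℂ)) :
    star (ψ x) * ψ y = π (E.preInner x y) := by
  rw [← sub_eq_zero, ← toeplitzDefect_apply]
  set F := E.toeplitzDefect ψ π
  have hloc : ∀ e e' : E1, ∃ U V : Set E1, IsOpen U ∧ IsOpen V ∧ e ∈ U ∧ e' ∈ V ∧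
      ∀ x y : C_c(E1, ℂ), tsupport x ⊆ U → tsupport y ⊆ V → F x y = 0 := by
    intro e e'
    obtain ⟨U, hU, he, hUs⟩ := E.exists_isOpen_isSSection e
    by_cases hee : e = e'
    · subst hee
      refine ⟨U, U, hU, hU, he, he, fun x y hx hy =>
        F.eq_zero_of_forall_self (p := supportedIn U) (fun z hz => ?_) hx hy⟩
      rw [E.toeplitzDefect_apply, ← h.map_hat z U hU hUs hz _
        (E.isHat_preInner z (hUs.mono ((subset_tsupport _).trans hz))), sub_self]
    · obtain ⟨V, hV, he', hVs⟩ := E.exists_isOpen_isSSection e'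
      obtain ⟨U', V', hU', hV', heU', heV', hd⟩ := t2_separation hee
      refine ⟨U ∩ U', V ∩ V', hU.inter hU', hV.inter hV', ⟨he, heU'⟩, ⟨he', heV'⟩,
        fun x y hx hy => ?_⟩
      have hd' : Disjoint (U ∩ U') (V ∩ V') := hd.mono inter_subset_right inter_subset_right
      rw [E.toeplitzDefect_apply, E.preInner_eq_zero_of_disjoint (hd'.mono hx hy), map_zero,
        sub_zero]
      exact h.star_mul_eq_zero x y _ _ (hU.inter hU') (hV.inter hV') (hUs.mono inter_subset_left)
        (hVs.mono inter_subset_left) hd' hx hy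
  choose U V hU hV hUe hVe hUV using hloc
  have hloc' : ∀ e : E1, ∃ A : Set E1, IsOpen A ∧ e ∈ A ∧
      ∀ x : C_c(E1, ℂ), tsupport x ⊆ A → F x y = 0 := by
    intro e
    -- The neighbourhoods depend on the pair of edges, so `y` is decomposed for each fixed `e`; only
    -- finitely many neighbourhoods of `e` then have to be intersected.
    obtain ⟨n, a, z, rfl, hz⟩ := y.exists_eq_sum_tsupport_subset (hV e) (hVe e)
    refine ⟨⋂ i, U e (a i), isOpen_iInter_of_finite fun i => hU _ _,
      mem_iInter.2 fun i => hUe _ _, fun x hx => ?_⟩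
    rw [map_sum]
    exact Finset.sum_eq_zero fun i _ =>
      hUV e (a i) x (z i) (hx.trans (iInter_subset _ i)) (hz i)
  choose A hA hAe hAy using hloc'
  obtain ⟨n, a, z, rfl, hz⟩ := x.exists_eq_sum_tsupport_subset hA hAe
  rw [map_sum, LinearMap.sum_apply]
  exact Finset.sum_eq_zero fun i _ => hAy (a i) (z i) (hz i)

lemma IsToeplitzRep.norm_apply_le {E : TopologicalGraph E0 E1} {ψ : C_c(E1, ℂ) →ₗ[ℂ] B}
    {π : C₀(E0, ℂ) →⋆ₙₐ[ℂ] B} (h : E.IsToeplitzRep ψ π) (x : C_c(E1, ℂ)) :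
    ‖ψ x‖ ≤ ‖E.toPre x‖ := by
  refine abs_le_of_sq_le_sq' ?_ (norm_nonneg _) |>.2
  rw [preCorr_norm_sq, sq, ← CStarRing.norm_star_mul_self, h.star_mul]
  exact NonUnitalStarAlgHom.norm_apply_le π _

/-- The extension to `X(E)` of the linear map of a Toeplitz representation. -/
def IsToeplitzRep.extension {E : TopologicalGraph E0 E1} {ψ : C_c(E1, ℂ) →ₗ[ℂ] B}
    {π : C₀(E0, ℂ) →⋆ₙₐ[ℂ] B} (h : E.IsToeplitzRep ψ π) : E.Corr →L[ℂ] B :=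
  E.extendCorr ((ψ ∘ₗ E.toPre.symm.toLinearMap).mkContinuous 1 fun x => by
    rw [one_mul]
    exact h.norm_apply_le (E.toPre.symm x))

lemma IsToeplitzRep.extension_toCorr {E : TopologicalGraph E0 E1} {ψ : C_c(E1, ℂ) →ₗ[ℂ] B}
    {π : C₀(E0, ℂ) →⋆ₙₐ[ℂ] B} (h : E.IsToeplitzRep ψ π) (x : C_c(E1, ℂ)) :
    h.extension (E.toCorr x) = ψ x :=
  E.extendCorr_toCorr _ x

lemma IsToeplitzRep.isToeplitzRep_extension {E : TopologicalGraph E0 E1}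
    {ψ : C_c(E1, ℂ) →ₗ[ℂ] B} {π : C₀(E0, ℂ) →⋆ₙₐ[ℂ] B} (h : E.IsToeplitzRep ψ π) :
    E.graphCorrespondence.IsToeplitzRep (h.extension : E.Corr →ₗ[ℂ] B) π where
  map_left a x := by
    change h.extension (E.corrLeft a x) = π a * h.extension x
    refine E.denseRange_toCorr.induction_on x (isClosed_eq (by fun_prop) (by fun_prop))
      fun x => ?_
    rw [corrLeft_toCorr, extension_toCorr, extension_toCorr, h.map_lact]
  star_mul x y := by
    change star (h.extension x) * h.extension y = π (E.corrIp x y)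
    have hπ : Continuous π := AddMonoidHomClass.continuous_of_bound π 1 fun a => by
      rw [one_mul]
      exact NonUnitalStarAlgHom.norm_apply_le π a
    refine E.denseRange_toCorr.induction_on₂ (p := fun x y => star (h.extension x) *
      h.extension y = π (E.corrIp x y)) (isClosed_eq (by fun_prop) (by fun_prop))
      (fun x y => ?_) x y
    rw [corrIp_toCorr, extension_toCorr, extension_toCorr, h.star_mul]

end TopologicalGraph

/-- For a family of maps that do not increase distances, convergence to `c` is a closed condition
on the argument. -/
lemma isClosed_setOf_tendsto_of_dist_le {ι V W : Type*} [PseudoMetricSpace V]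
    [PseudoMetricSpace W] {L : ι → V → W} (hL : ∀ i x y, dist (L i x) (L i y) ≤ dist x y)
    (l : Filter ι) (c : W) : IsClosed {x | Tendsto (fun i => L i x) l (𝓝 c)} := by
  refine isClosed_of_closure_subset fun x hx => Metric.tendsto_nhds.2 fun ε hε => ?_
  obtain ⟨y, hy, hxy⟩ := Metric.mem_closure_iff.1 hx (ε / 2) (half_pos hε)
  filter_upwards [Metric.tendsto_nhds.1 hy (ε / 2) (half_pos hε)] with i hi
  linarith [dist_triangle (L i x) (L i y) c, hL i x y]

/-! ### Functions acting by compacts and orthogonal to the kernel vanish off the regular vertices.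
-/

namespace TopologicalGraph

variable {E0 E1 : Type*} [TopologicalSpace E0] [TopologicalSpace E1] [T2Space E0] [T2Space E1]
  [LocallyCompactSpace E1]

/-- `|x(e)|²` is one of the nonnegative terms of `⟨x, x⟩(s(e))`. Hence evaluation at an edge passes
to the completion. -/
lemma norm_apply_le_toPre (E : TopologicalGraph E0 E1) (x : C_c(E1, ℂ)) (e : E1) :
    ‖x e‖ ≤ ‖E.toPre x‖ := by
  refine abs_le_of_sq_le_sq' ?_ (norm_nonneg _) |>.2
  have h := CStarAlgebra.norm_le_norm_of_nonneg_of_le (star_mul_self_nonneg (x e))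
    (E.fiberSum_self x e)
  rw [CStarRing.norm_star_mul_self, ← sq] at h
  rw [preCorr_norm_sq]
  exact h.trans (norm_apply_le _ _)

/-- Evaluation at an edge, as a functional on `X(E)`. -/
def evalCorr (E : TopologicalGraph E0 E1) (e : E1) : E.Corr →L[ℂ] ℂ :=
  E.extendCorr (LinearMap.mkContinuous
    { toFun := fun x => E.toPre.symm x e
      map_add' := fun x y => by rw [map_add]; rfl
      map_smul' := fun c x => by rw [map_smul]; rfl } 1 fun x => by
        rw [one_mul]
        exact E.norm_apply_le_toPre (E.toPre.symm x) e)

lemma evalCorr_toCorr (E : TopologicalGraph E0 E1) (e : E1) (x : C_c(E1, ℂ)) :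
    E.evalCorr e (E.toCorr x) = x e :=
  E.extendCorr_toCorr _ x

lemma norm_evalCorr_le (E : TopologicalGraph E0 E1) (e : E1) (x : E.Corr) :
    ‖E.evalCorr e x‖ ≤ ‖x‖ := by
  refine E.denseRange_toCorr.induction_on x (isClosed_le (by fun_prop) (by fun_prop)) fun x => ?_
  rw [evalCorr_toCorr, norm_toCorr]
  exact E.norm_apply_le_toPre x e

lemma evalCorr_corrRight (E : TopologicalGraph E0 E1) (e : E1) (x : E.Corr) (f : C₀(E0, ℂ)) :
    E.evalCorr e (E.corrRight x f) = E.evalCorr e x * f (E.s e) := by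
  refine E.denseRange_toCorr.induction_on x (isClosed_eq (by fun_prop) (by fun_prop)) fun x => ?_
  rw [corrRight_toCorr, evalCorr_toCorr, evalCorr_toCorr]
  rfl

lemma tendsto_evalCorr (E : TopologicalGraph E0 E1) (x : E.Corr) :
    Tendsto (fun e => E.evalCorr e x) (cocompact E1) (𝓝 0) := by
  refine E.denseRange_toCorr.induction_on x
    (isClosed_setOf_tendsto_of_dist_le (fun e x y => ?_) _ _) fun x => ?_
  · rw [dist_eq_norm, dist_eq_norm, ← map_sub]
    exact E.norm_evalCorr_le e _
  · simp only [evalCorr_toCorr]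
    exact x.hasCompactSupport.is_zero_at_infty

/-- For `Θ_{x,y}` the functional at `e` is `z ↦ x(e) ⟨y, z⟩(s(e))`, of norm at most `|x(e)|` times a
constant, and `x` vanishes at infinity. The property survives sums, scalar multiples and norm
limits. -/
lemma tendsto_evalCorr_comp (E : TopologicalGraph E0 E1) {T : E.Corr →L[ℂ] E.Corr}
    (hT : T ∈ E.graphCorrespondence.compacts) :
    Tendsto (fun e => (E.evalCorr e).comp T) (cocompact E1) (𝓝 0) := by
  refine closure_minimal (fun T hT => ?_) (isClosed_setOf_tendsto_of_dist_le
    (L := fun e (T : E.Corr →L[ℂ] E.Corr) => (E.evalCorr e).comp T) (fun e S T => ?_)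
    (cocompact E1) 0) hT
  · change Tendsto (fun e => (E.evalCorr e).comp T) (cocompact E1) (𝓝 0)
    replace hT : T ∈ Submodule.span ℂ (range (uncurry E.graphCorrespondence.theta)) := hT
    induction hT using Submodule.span_induction with
    | mem _ hx =>
      obtain ⟨⟨x, y⟩, rfl⟩ := hx
      refine squeeze_zero_norm (a := fun e => ‖E.evalCorr e x‖ * ‖E.corrIp y‖) (fun e => ?_) ?_
      · refine ContinuousLinearMap.opNorm_le_bound _ (by positivity) fun z => ?_
        change ‖E.evalCorr e (E.corrRight x (E.corrIp y z))‖ ≤ _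
        rw [evalCorr_corrRight, norm_mul, mul_assoc]
        gcongr
        exact (norm_apply_le _ _).trans ((E.corrIp y).le_opNorm z)
      · simpa using (E.tendsto_evalCorr x).norm.mul_const ‖E.corrIp y‖
    | zero => simpa using tendsto_const_nhds
    | add S T _ _ h1 h2 => simpa [ContinuousLinearMap.comp_add] using h1.add h2
    | smul c T _ h1 =>
      refine squeeze_zero_norm (a := fun e => ‖c‖ * ‖(E.evalCorr e).comp T‖) (fun e => ?_)
        (by simpa using h1.norm.const_mul ‖c‖)
      rw [ContinuousLinearMap.comp_smul]
      exact (norm_smul c _).le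
  · rw [dist_eq_norm, dist_eq_norm, ← ContinuousLinearMap.comp_sub]
    refine ContinuousLinearMap.opNorm_le_bound _ (norm_nonneg _) fun z => ?_
    exact (E.norm_evalCorr_le e _).trans ((S - T).le_opNorm z)

/-- A bump function supported in an `s`-section works: each fibre sum of `|z|²` has at most one
nonzero term, so `⟨z, z⟩ ≤ 1`. -/
lemma exists_apply_eq_one (E : TopologicalGraph E0 E1) (e : E1) :
    ∃ z : C_c(E1, ℂ), z e = 1 ∧ ‖E.toCorr z‖ ≤ 1 := by
  obtain ⟨U, hU, he, hUs⟩ := E.exists_isOpen_isSSection e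
  obtain ⟨f, hf1, hf2, hf3, hf4⟩ := exists_continuousMap_one_of_isCompact_subset_isOpen
    (isCompact_singleton (x := e)) hU (singleton_subset_iff.2 he)
  let z : C_c(E1, ℂ) := ⟨⟨fun e => (f e : ℂ), by fun_prop⟩,
    HasCompactSupport.comp_left (g := fun t : ℝ => (t : ℂ)) hf2 (by simp)⟩
  have hz : ∀ e, z e = (f e : ℂ) := fun _ => rfl
  refine ⟨z, by simp [hz, hf1 (mem_singleton e)], ?_⟩
  refine abs_le_of_sq_le_sq' ?_ zero_le_one |>.2
  rw [norm_toCorr_sq, one_pow, ← ZeroAtInftyContinuousMap.norm_toBCF_eq_norm]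
  refine (BoundedContinuousFunction.norm_le zero_le_one).2 fun v => ?_
  change ‖E.preInner z z v‖ ≤ 1
  have hsub : (support fun e => star (z e) * z e) ⊆ U := fun e he => by
    refine hf3 (subset_tsupport _ fun h0 => he ?_)
    simp [hz, h0]
  rw [preInner_apply]
  by_cases hv : v ∈ E.s '' (support fun e => star (z e) * z e)
  · obtain ⟨e, he, rfl⟩ := hv
    rw [E.fiberSum_apply_of_injOn hUs.injOn hsub (hsub he), CStarRing.norm_star_mul_self, hz,
      Complex.norm_real, Real.norm_of_nonneg (hf4 e).1]
    exact mul_le_one₀ (hf4 e).2 (hf4 e).1 (hf4 e).2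
  · rw [E.fiberSum_eq_zero hv, norm_zero]
    exact zero_le_one

lemma norm_apply_r_le (E : TopologicalGraph E0 E1) (a : C₀(E0, ℂ)) (e : E1) :
    ‖a (E.r e)‖ ≤ ‖(E.evalCorr e).comp (E.corrLeft a)‖ := by
  obtain ⟨z, hz, hz1⟩ := E.exists_apply_eq_one e
  have h := ((E.evalCorr e).comp (E.corrLeft a)).le_opNorm (E.toCorr z)
  rw [ContinuousLinearMap.comp_apply, corrLeft_toCorr, evalCorr_toCorr] at h
  have h1 : E.lact a z e = a (E.r e) := by
    change a (E.r e) * z e = _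
    rw [hz, mul_one]
  rw [h1] at h
  exact h.trans (mul_le_of_le_one_right (norm_nonneg _) hz1)

/-- Since `|a(r(e))|` is at most the norm of evaluation at `e` after `φ(a)`, the function `a ∘ r`
vanishes at infinity on `E¹` when `φ(a)` is compact. -/
lemma mem_fin_of_left_mem_compacts (E : TopologicalGraph E0 E1) {a : C₀(E0, ℂ)}
    (ha : E.graphCorrespondence.left a ∈ E.graphCorrespondence.compacts) {v : E0} (hv : a v ≠ 0) :
    v ∈ E.fin := by
  have hpos : 0 < ‖a v‖ / 2 := by positivity
  obtain ⟨K, hK, hKa⟩ := mem_cocompact.1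
    ((E.tendsto_evalCorr_comp ha).norm.eventually (gt_mem_nhds (by rwa [norm_zero])))
  have hc : Continuous fun w => ‖a w‖ := by fun_prop
  -- The non-strict inequality makes the preimage closed, hence compact as a subset of `K`.
  refine ⟨{w | ‖a v‖ / 2 ≤ ‖a w‖}, ?_, ?_⟩
  · filter_upwards [hc.continuousAt.eventually (lt_mem_nhds (half_lt_self (norm_pos_iff.2 hv)))]
      with w hw using hw.le
  · refine hK.of_isClosed_subset
      ((isClosed_le continuous_const hc).preimage E.continuous_r) fun e he => ?_
    by_contra heK
    exact absurd (he.trans (E.norm_apply_r_le a e)) (not_le.2 (hKa heK))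

lemma corrLeft_eq_zero (E : TopologicalGraph E0 E1) {b : C₀(E0, ℂ)}
    (hb : ∀ e, b (E.r e) = 0) : E.corrLeft b = 0 := by
  ext1 x
  refine E.denseRange_toCorr.induction_on x (isClosed_eq (by fun_prop) (by fun_prop)) fun x => ?_
  have : E.lact b x = 0 := by
    ext e
    change b (E.r e) * x e = 0
    rw [hb, zero_mul]
  rw [corrLeft_toCorr, this, map_zero]
  rfl

variable [LocallyCompactSpace E0]

/-- A bump function at `v ∈ E⁰_sce` supported off the closure of `r(E¹)` lies in `ker φ`, so its
product with `a` is zero and `a(v) = 0`; continuity of `a` covers the closure. -/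
lemma eq_zero_of_mem_closure_sce (E : TopologicalGraph E0 E1) {a : C₀(E0, ℂ)}
    (ha : ∀ b, E.graphCorrespondence.left b = 0 → a * b = 0) {v : E0} (hv : v ∈ closure E.sce) :
    a v = 0 := by
  refine closure_minimal (fun v hv => ?_)
    (isClosed_eq (f := a) (g := fun _ => 0) (by fun_prop) continuous_const) hv
  obtain ⟨f, hf1, hf2, hf3, -⟩ := exists_continuousMap_one_of_isCompact_subset_isOpen
    (isCompact_singleton (x := v)) isClosed_closure.isOpen_compl (singleton_subset_iff.2 hv)
  have hfc : HasCompactSupport fun w => (f w : ℂ) :=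
    HasCompactSupport.comp_left (g := fun t : ℝ => (t : ℂ)) hf2 (by simp)
  let b : C₀(E0, ℂ) := ⟨⟨fun w => (f w : ℂ), by fun_prop⟩, hfc.is_zero_at_infty⟩
  have hb : ∀ w, b w = (f w : ℂ) := fun _ => rfl
  have h := DFunLike.congr_fun (ha b (E.corrLeft_eq_zero fun e => ?_)) v
  · simpa [hb, hf1 (mem_singleton v)] using h
  · rw [hb, Complex.ofReal_eq_zero]
    by_contra h0
    exact hf3 (subset_tsupport _ h0) (subset_closure (mem_range_self e))

lemma eq_zero_of_notMem_rg (E : TopologicalGraph E0 E1) {a : C₀(E0, ℂ)}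
    (ha : E.graphCorrespondence.left a ∈ E.graphCorrespondence.compacts)
    (hker : ∀ b, E.graphCorrespondence.left b = 0 → a * b = 0) {v : E0} (hv : v ∉ E.rg) :
    a v = 0 := by
  by_contra h0
  exact hv ⟨E.mem_fin_of_left_mem_compacts ha h0,
    fun h => h0 (E.eq_zero_of_mem_closure_sce hker h)⟩

end TopologicalGraph

/-! ### Compatible partitions and covariance. -/

namespace TopologicalGraph

variable {E0 E1 : Type*} [TopologicalSpace E0] [TopologicalSpace E1] [T2Space E0] [T2Space E1]
  [LocallyCompactSpace E1] {B : Type*} [NonUnitalCStarAlgebra B]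

/-- The support of `g N` lies in an `s`-section, so the fibre sum through an edge where `g N` is
nonzero reduces to the term at that edge, and the two square roots multiply to `g N`. -/
lemma IsPartition.ract_sqrtCc_apply {E : TopologicalGraph E0 E1} {f : C₀(E0, ℂ)}
    {𝒩 : Finset (Set E1)} {g : Set E1 → C_c(E1, ℝ)} (hg : E.IsPartition f 𝒩 g)
    (h𝒩 : E.IsSSectionCover f 𝒩) {N : Set E1} (hN : N ∈ 𝒩) (z : C_c(E1, ℂ)) (e : E1) :
    E.ract (sqrtCc (g N)) (E.preInner (sqrtCc (g N)) z) e = (g N e : ℂ) * z e := by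
  have hsq : ∀ e, sqrtCc (g N) e = ((√(g N e) : ℝ) : ℂ) := fun _ => rfl
  change sqrtCc (g N) e * E.preInner (sqrtCc (g N)) z (E.s e) = _
  by_cases h0 : g N e = 0
  · simp [hsq, h0]
  have hsub : (support fun e => star (sqrtCc (g N) e) * z e) ⊆ N := fun e he => by
    refine (hg.support_subset N hN fun h0 => he ?_).1
    simp [hsq, h0]
  rw [preInner_apply, E.fiberSum_apply_of_injOn (h𝒩.isSSection N hN).injOn hsub
    (hg.support_subset N hN h0).1, ← mul_assoc, hsq, Complex.star_def, Complex.conj_ofReal,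
    ← Complex.ofReal_mul, Real.mul_self_sqrt (hg.nonneg N hN e)]

/-- Each rank-one operator multiplies by `g N`, and the `g N` add up to `f ∘ r`. This exhibits
`φ(f)` as a finite sum of rank-one operators. -/
lemma IsPartition.sum_theta_apply {E : TopologicalGraph E0 E1} {f : C₀(E0, ℂ)}
    {𝒩 : Finset (Set E1)} {g : Set E1 → C_c(E1, ℝ)} (hg : E.IsPartition f 𝒩 g)
    (h𝒩 : E.IsSSectionCover f 𝒩) (z : E.Corr) :
    ∑ N ∈ 𝒩, E.graphCorrespondence.theta (E.toCorr (sqrtCc (g N))) (E.toCorr (sqrtCc (g N))) z =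
      E.graphCorrespondence.left f z := by
  change _ = E.corrLeft f z
  refine E.denseRange_toCorr.induction_on z (isClosed_eq (by fun_prop) (by fun_prop)) fun z => ?_
  have h1 : ∀ x : C_c(E1, ℂ), E.graphCorrespondence.theta (E.toCorr x) (E.toCorr x) (E.toCorr z) =
      E.toCorr (E.ract x (E.preInner x z)) := fun x => by
    rw [← corrRight_toCorr, ← corrIp_toCorr]
    rfl
  simp only [h1]
  rw [← map_sum, corrLeft_toCorr]
  congr 1
  ext e
  rw [CompactlySupportedContinuousMap.sum_apply]
  change _ = f (E.r e) * z e
  rw [← hg.sum_eq, Complex.ofReal_sum, Finset.sum_mul]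
  exact Finset.sum_congr rfl fun N hN => hg.ract_sqrtCc_apply h𝒩 hN z e

variable {E : TopologicalGraph E0 E1} {ψ : C_c(E1, ℂ) →ₗ[ℂ] B} {π : C₀(E0, ℂ) →⋆ₙₐ[ℂ] B}

/-- A covariant representation maps `C₀(E⁰_rg)` into the closed span of the `ψ(x) ψ(y)^*`. -/
lemma IsCovariantRep.map_mem_rankOneClosure (h : E.IsCovariantRep ψ π) {f : C₀(E0, ℂ)}
    (hf : ∀ v ∉ E.rg, f v = 0) :
    π f ∈ h.toIsToeplitzRep.isToeplitzRep_extension.rankOneClosure := by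
  set hT := h.toIsToeplitzRep.isToeplitzRep_extension
  obtain ⟨G, -, hG, hGπ⟩ := h.covariant
  have hπ : Continuous π := AddMonoidHomClass.continuous_of_bound π 1 fun a => by
    rw [one_mul]
    exact NonUnitalStarAlgHom.norm_apply_le π a
  -- The preimage of the closed span under `π` is a closed `*`-subalgebra, so it suffices that it
  -- contains `G`, where the covariance formula displays `π(f)` as a sum of elements `ψ(x) ψ(x)^*`.
  have hle : (NonUnitalStarAlgebra.adjoin ℂ G).topologicalClosure ≤
      NonUnitalStarSubalgebra.comap π hT.rankOneClosure := by
    refine NonUnitalStarSubalgebra.topologicalClosure_minimal _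
      (NonUnitalStarAlgebra.adjoin_le fun f hf => ?_) ?_
    · obtain ⟨𝒩, g, -, -, hsum⟩ := hGπ f hf
      change π f ∈ hT.rankOneClosure
      rw [hsum]
      refine sum_mem fun N _ => ?_
      rw [← h.extension_toCorr]
      exact hT.mul_star_mem _ _
    · exact (NonUnitalStarSubalgebra.isClosed_topologicalClosure _).preimage hπ
  have hmem : f ∈ ((NonUnitalStarAlgebra.adjoin ℂ G).topologicalClosure : Set C₀(E0, ℂ)) := by
    rw [hG]
    exact hf
  exact hle hmem

/-- Both sides implement `φ(f)`, so they agree by `Implements.unique`. The partition is arbitrary: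
covariance entered only in placing `π(f)` in the closed span. -/
lemma IsCovariantRep.map_eq_sum (h : E.IsCovariantRep ψ π) {f : C₀(E0, ℂ)}
    (hf : E.IsNonnegCcRg f) {𝒩 : Finset (Set E1)} (h𝒩 : E.IsSSectionCover f 𝒩)
    {g : Set E1 → C_c(E1, ℝ)} (hg : E.IsPartition f 𝒩 g) :
    π f = ∑ N ∈ 𝒩, ψ (sqrtCc (g N)) * star (ψ (sqrtCc (g N))) := by
  set hT := h.toIsToeplitzRep.isToeplitzRep_extension
  have hrg : ∀ v ∉ E.rg, f v = 0 := fun v hv =>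
    image_eq_zero_of_notMem_tsupport fun hv' => hv (hf.tsupport_subset hv')
  have h1 : hT.Implements (π f) (E.graphCorrespondence.left f) :=
    ⟨h.map_mem_rankOneClosure hrg, fun z => (hT.map_left f z).symm⟩
  refine h1.unique ⟨sum_mem fun N _ => ?_, fun z => ?_⟩
  · rw [← h.extension_toCorr]
    exact hT.mul_star_mem _ _
  · rw [← hg.sum_theta_apply h𝒩, map_sum, Finset.sum_mul]
    refine Finset.sum_congr rfl fun N _ => ?_
    rw [← h.extension_toCorr]
    exact (CStarCorrespondence.IsToeplitzRep.Implements.theta hT _ _).mul_apply z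

end TopologicalGraph

end

theorem mainTheorem6 {E0 E1 : Type*} [TopologicalSpace E0] [T2Space E0] [LocallyCompactSpace E0]
    [TopologicalSpace E1] [T2Space E1] [LocallyCompactSpace E1] (E : TopologicalGraph E0 E1)
    {B : Type*} [NonUnitalCStarAlgebra B] (ψ : C_c(E1, ℂ) →ₗ[ℂ] B) (π : C₀(E0, ℂ) →⋆ₙₐ[ℂ] B)
    (hψπ : E.IsCovariantRep ψ π) :
    (∃ ψ' : E.Corr →L[ℂ] B,
      ((∀ x : C_c(E1, ℂ), ψ' (E.toCorr x) = ψ x) ∧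
        ∀ ψ'' : E.Corr →L[ℂ] B, (∀ x : C_c(E1, ℂ), ψ'' (E.toCorr x) = ψ x) → ψ'' = ψ') ∧
      E.graphCorrespondence.IsCovariantRep (ψ' : E.Corr →ₗ[ℂ] B) π) ∧
    ∀ f : C₀(E0, ℂ), E.IsNonnegCcRg f →
      ∀ 𝒩 : Finset (Set E1), E.IsSSectionCover f 𝒩 →
        ∀ g : Set E1 → C_c(E1, ℝ), E.IsPartition f 𝒩 g →
          π f = ∑ N ∈ 𝒩, ψ (TopologicalGraph.sqrtCc (g N)) *
            star (ψ (TopologicalGraph.sqrtCc (g N))) := by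
  refine ⟨⟨hψπ.toIsToeplitzRep.extension, ⟨hψπ.extension_toCorr, fun ψ'' h => ?_⟩, ?_⟩,
    fun f hf 𝒩 h𝒩 g hg => hψπ.map_eq_sum hf h𝒩 hg⟩
  · refine DFunLike.coe_injective (E.denseRange_toCorr.equalizer ψ''.continuous
      hψπ.toIsToeplitzRep.extension.continuous (funext fun x => ?_))
    exact (h x).trans (hψπ.extension_toCorr x).symm
  · exact hψπ.toIsToeplitzRep.isToeplitzRep_extension.isCovariantRep fun a ha hker =>
      hψπ.map_mem_rankOneClosure fun v hv => E.eq_zero_of_notMem_rg ha hker hv
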